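/- **Setting.** Let $d\ge 1$ and let $(\Omega,\mathcal F,\mathbb P)$ be a probability space on which the group $(\mathbb Z^d,+)$ acts by measurable maps $(\tau_k)_{k\in\mathbb Z^d}$ preserving $\mathbb P$. For an integer $N\ge 0$ let $Q_N=[-N-\tfrac12,N+\tfrac12]^d$ and $Q=Q_0$. A field $F$ on $\mathbb R^d\times\Omega$ is stationary if, for all $k\in\mathbb Z^d$, $F(x+k,\omega)=F(x,\tau_k\omega)$ almost everywhere and almost surely. $|\cdot|$ is the Euclidean norm of vectors and the operator norm of matrices; $\|v\|_{L^\infty(Q\times\Omega)}=\operatorname{ess\,sup}_{Q\times\Omega}|v|$. $H^1_{\rm per}(Q_N)$ is the closure, for the $H^1(Q_N)$ norm, of the smooth $Q_N$-periodic functions; its elements and their gradients are extended by periodicity to $\mathbb R^d$. For $0<|\eta|\le 1$ let $A_\eta\in L^\infty(\mathbb R^d\times\Omega)^{d\times d}$ be symmetric and stationary, and let $\gamma>0$ and $M$ be constants independent of $\eta$ such that $\|A_\eta\|_{L^\infty(\mathbb R^d\times\Omega)}\le M$ and, for all $\xi\in\mathbb R^d$, $\xi^TA_\eta(x,\omega)\xi\ge\gamma|\xi|^2$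 almost everywhere and almost surely. Let $A_{\rm per}\in L^\infty(Q)^{d\times d}$, extended $\mathbb Z^d$-periodically, and $A_1\in L^\infty(Q\times\Omega)^{d\times d}$, extended to $\mathbb R^d\times\Omega$ by stationarity, be such that, as $\eta\to0$, $$\|A_\eta-A_{\rm per}\|_{L^\infty(Q\times\Omega)}\to0,\qquad \|\eta^{-1}(A_\eta-A_{\rm per})-A_1\|_{L^\infty(Q\times\Omega)}\to0,$$ and such that, for a constant $C_R$ and all $0<|\eta|\le1$, $\eta^{-2}\|A_\eta-A_{\rm per}-\eta A_1\|_{L^\infty(Q\times\Omega)}\le C_R$. **Correctors.** For $p\in\mathbb R^d$ consider the problems: find $w^{\eta,N}_p(\cdot,\omega)\in H^1_{\rm per}(Q_N)$, $w^0_p\in H^1_{\rm per}(Q)$ and $w^{1,N}_p(\cdot,\omega)\in H^1_{\rm per}(Q_N)$ with $$\int_{Q_N}A_\eta(\cdot,\omega)\bigl(p+\nabla w^{\eta,N}_p(\cdot,\omega)\bigr)\cdot\nabla\varphi=0\quad\forall\varphi\in H^1_{\rm per}(Q_N),$$ $$\int_{Q}A_{\rm per}\bigl(p+\nabla w^{0}_p\bigr)\cdot\nabla\varphi=0\quad\forall\varphi\in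 H^1_{\rm per}(Q),$$ $$\int_{Q_N}A_{\rm per}\nabla w^{1,N}_p(\cdot,\omega)\cdot\nabla\varphi+\int_{Q_N}A_1(\cdot,\omega)\bigl(p+\nabla w^0_p\bigr)\cdot\nabla\varphi=0\quad\forall\varphi\in H^1_{\rm per}(Q_N).$$ Define $$[A^{\star,N}_\eta]_{ij}(\omega)=\frac1{|Q_N|}\int_{Q_N}e_i^TA_\eta(\cdot,\omega)\bigl(e_j+\nabla w^{\eta,N}_{e_j}(\cdot,\omega)\bigr),\qquad [A^\star_{\rm per}]_{ij}=\int_Qe_i^TA_{\rm per}\bigl(e_j+\nabla w^0_{e_j}\bigr),$$ $$[A^{\star,N}_1]_{ij}(\omega)=\frac1{|Q_N|}\int_{Q_N}e_i^TA_{\rm per}\nabla w^{1,N}_{e_j}(\cdot,\omega)+\frac1{|Q_N|}\int_{Q_N}e_i^TA_1(\cdot,\omega)\bigl(\nabla w^0_{e_j}+e_j\bigr).$$ **Statement.** The second problem has a solution; for all $N$ and all $0<|\eta|\le1$ the first and the third have solutions almost surely; in each case the gradient of the solution is unique almost everywhere. Moreover there is a constant $C$, independent of $N$, $\eta$ and $\omega$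 (and of $p$), such that for all $N$, all $0<|\eta|\le1$ and all $p$ with $|p|=1$, $$\eta^{-2}\bigl\|\nabla w^{\eta,N}_p(\cdot,\omega)-\nabla w^0_p-\eta\nabla w^{1,N}_p(\cdot,\omega)\bigr\|_{L^2(Q_N)^d}\le C\sqrt{|Q_N|}\quad\text{almost surely},$$ $$\eta^{-2}\bigl|A^{\star,N}_\eta(\omega)-A^\star_{\rm per}-\eta A^{\star,N}_1(\omega)\bigr|\le C\quad\text{almost surely}.$$ -/

import Mathlib

open MeasureTheory Filter Topology
open scoped Matrix ENNReal NNReal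
-- the norm of a real matrix is its operator norm for the Euclidean norm
open scoped Matrix.Norms.L2Operator

noncomputable section

namespace WeakHom

/-- The Euclidean space `ℝ^d`. -/
abbrev E (d : ℕ) : Type := EuclideanSpace ℝ (Fin d)

/-- The cube `Q_N = [-N - 1/2, N + 1/2]^d`; the unit cell `Q` is `cube d 0`. -/
def cube (d N : ℕ) : Set (E d) :=
  {x | ∀ i, x i ∈ Set.Icc (-(N : ℝ) - 1 / 2) ((N : ℝ) + 1 / 2)}

/-- A vector of integers, seen as an element of `ℝ^d`. -/
def intVec {d : ℕ} (k : Fin d → ℤ) : E d := WithLp.toLp 2 (fun i => (k i : ℝ))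

/-- Lebesgue measure on `Q_N`. -/
abbrev cubeMeasure (d N : ℕ) : Measure (E d) := volume.restrict (cube d N)

/-- Matrix-vector product on `ℝ^d`. -/
def act {d : ℕ} (a : Matrix (Fin d) (Fin d) ℝ) (v : E d) : E d := WithLp.toLp 2 (a *ᵥ v.ofLp)

/-- `Q_N`-periodicity (period `2N + 1` in every coordinate direction), almost everywhere.
For `N = 0` this is `Q`-periodicity, i.e. `ℤ^d`-periodicity. -/
def AEPeriodic {d : ℕ} {β : Type*} (N : ℕ) (f : E d → β) : Prop :=
  ∀ k : Fin d → ℤ, ∀ᵐ x : E d, f (x + (2 * (N : ℝ) + 1) • intVec k) = f x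

/-- `Q_N`-periodicity at every point. -/
def Periodic {d : ℕ} {β : Type*} (N : ℕ) (f : E d → β) : Prop :=
  ∀ (k : Fin d → ℤ) (x : E d), f (x + (2 * (N : ℝ) + 1) • intVec k) = f x

/-- `w ∈ H¹_per(Q_N)` and `∇w = g`. Here `H¹_per(Q_N)` is the closure, for the `H¹(Q_N)` norm,
of the smooth `Q_N`-periodic functions; `w` and its gradient `g` are extended to `ℝ^d` by
periodicity. -/
structure IsH1Per {d : ℕ} (N : ℕ) (w : E d → ℝ) (g : E d → E d) : Prop where
  memLp_fun : MemLp w 2 (cubeMeasure d N)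
  memLp_grad : MemLp g 2 (cubeMeasure d N)
  periodic_fun : AEPeriodic N w
  periodic_grad : AEPeriodic N g
  exists_approx : ∃ φ : ℕ → E d → ℝ,
    (∀ n, ContDiff ℝ (⊤ : ℕ∞) (φ n)) ∧ (∀ n, Periodic N (φ n)) ∧
    Tendsto (fun n => eLpNorm (fun x => φ n x - w x) 2 (cubeMeasure d N)) atTop (𝓝 0) ∧
    Tendsto (fun n => eLpNorm (fun x => gradient (φ n) x - g x) 2 (cubeMeasure d N))
      atTop (𝓝 0)

/-- `w ∈ H¹_per(Q_N)`, with gradient `g`, solves the corrector problem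
`∫_{Q_N} a (p + ∇w) · ∇φ = 0` for all `φ ∈ H¹_per(Q_N)`. -/
def IsCorrector {d : ℕ} (N : ℕ) (a : E d → Matrix (Fin d) (Fin d) ℝ) (p : E d)
    (w : E d → ℝ) (g : E d → E d) : Prop :=
  IsH1Per N w g ∧ ∀ φ ψ, IsH1Per N φ ψ →
    ∫ x in cube d N, inner ℝ (act (a x) (p + g x)) (ψ x) = 0

/-- `w ∈ H¹_per(Q_N)`, with gradient `g`, solves the first order corrector problem
`∫_{Q_N} a₀ ∇w · ∇φ + ∫_{Q_N} a₁ (p + ∇w⁰) · ∇φ = 0` for all `φ ∈ H¹_per(Q_N)`,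
where `g₀ = ∇w⁰`. -/
def IsFirstOrderCorrector {d : ℕ} (N : ℕ) (a₀ a₁ : E d → Matrix (Fin d) (Fin d) ℝ) (p : E d)
    (g₀ : E d → E d) (w : E d → ℝ) (g : E d → E d) : Prop :=
  IsH1Per N w g ∧ ∀ φ ψ, IsH1Per N φ ψ →
    (∫ x in cube d N, inner ℝ (act (a₀ x) (g x)) (ψ x)) +
      ∫ x in cube d N, inner ℝ (act (a₁ x) (p + g₀ x)) (ψ x) = 0

/-- The matrix with entries `|Q_N|⁻¹ ∫_{Q_N} e_i^T a (e_j + g_j)`, where `g_j` is the gradient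
of the corrector in the direction `e_j`. For `N = 0` the factor `|Q|⁻¹` is one. -/
def homMatrix {d : ℕ} (N : ℕ) (a : E d → Matrix (Fin d) (Fin d) ℝ) (g : Fin d → E d → E d) :
    Matrix (Fin d) (Fin d) ℝ :=
  Matrix.of fun i j => (volume.real (cube d N))⁻¹ *
    ∫ x in cube d N, act (a x) (EuclideanSpace.single j 1 + g j x) i

/-- The matrix with entries
`|Q_N|⁻¹ ∫_{Q_N} e_i^T a₀ g¹_j + |Q_N|⁻¹ ∫_{Q_N} e_i^T a₁ (g⁰_j + e_j)`. -/
def firstOrderMatrix {d : ℕ} (N : ℕ) (a₀ a₁ : E d → Matrix (Fin d) (Fin d) ℝ)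
    (g₀ g₁ : Fin d → E d → E d) : Matrix (Fin d) (Fin d) ℝ :=
  Matrix.of fun i j =>
    (volume.real (cube d N))⁻¹ * (∫ x in cube d N, act (a₀ x) (g₁ j x) i) +
    (volume.real (cube d N))⁻¹ *
      ∫ x in cube d N, act (a₁ x) (g₀ j x + EuclideanSpace.single j 1) i

/-- Discrete stationarity: `F(x + k, ω) = F(x, τ_k ω)` for all `k ∈ ℤ^d`, almost everywhere and
almost surely. -/
def Stationary {d : ℕ} {Ω : Type*} [MeasurableSpace Ω] [AddAction (Fin d → ℤ) Ω] {β : Type*}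
    (P : Measure Ω) (F : E d → Ω → β) : Prop :=
  ∀ k : Fin d → ℤ, ∀ᵐ z : E d × Ω ∂(volume.prod P), F (z.1 + intVec k) z.2 = F z.1 (k +ᵥ z.2)

/-- The norm in `L^∞(Q × Ω)^{d × d}`: the essential supremum of the matrix norm. -/
def normInf {d : ℕ} {Ω : Type*} [MeasurableSpace Ω] (P : Measure Ω)
    (F : E d → Ω → Matrix (Fin d) (Fin d) ℝ) : ℝ≥0∞ :=
  eLpNorm (fun z : E d × Ω => F z.1 z.2) ∞ ((cubeMeasure d 0).prod P)

/-- The standing hypotheses on the random matrices `A_η`, `0 < |η| ≤ 1`: `A_η` is essentially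
bounded by `M` on `ℝ^d × Ω`, symmetric, coercive with constant `γ`, and stationary. -/
structure IsAdmissible {d : ℕ} {Ω : Type*} [MeasurableSpace Ω] [AddAction (Fin d → ℤ) Ω]
    (P : Measure Ω) (γ : ℝ) (M : ℝ≥0) (A : ℝ → E d → Ω → Matrix (Fin d) (Fin d) ℝ) : Prop where
  memLp : ∀ η : ℝ, η ≠ 0 → |η| ≤ 1 →
    MemLp (fun z : E d × Ω => A η z.1 z.2) ∞ (volume.prod P)
  bounded : ∀ η : ℝ, η ≠ 0 → |η| ≤ 1 →
    eLpNorm (fun z : E d × Ω => A η z.1 z.2) ∞ (volume.prod P) ≤ M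
  symmetric : ∀ η : ℝ, η ≠ 0 → |η| ≤ 1 →
    ∀ᵐ z : E d × Ω ∂(volume.prod P), (A η z.1 z.2).IsSymm
  coercive : ∀ η : ℝ, η ≠ 0 → |η| ≤ 1 →
    ∀ ξ : E d, ∀ᵐ z : E d × Ω ∂(volume.prod P), γ * ‖ξ‖ ^ 2 ≤ inner ℝ ξ (act (A η z.1 z.2) ξ)
  stationary : ∀ η : ℝ, η ≠ 0 → |η| ≤ 1 → Stationary P (A η)

/-- The expansion `A_η = A_per + η A_1 + O(η²)` in `L^∞(Q × Ω)^{d × d}`, with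
`A_per ∈ L^∞(Q)^{d × d}` and `A_1 ∈ L^∞(Q × Ω)^{d × d}`. The matrices `A_per` and `A_1`, given
by the expansion on `Q`, are extended to `ℝ^d` by periodicity and by stationarity. -/
structure HasExpansion {d : ℕ} {Ω : Type*} [MeasurableSpace Ω] [AddAction (Fin d → ℤ) Ω]
    (P : Measure Ω) (A : ℝ → E d → Ω → Matrix (Fin d) (Fin d) ℝ)
    (Aper : E d → Matrix (Fin d) (Fin d) ℝ) (A₁ : E d → Ω → Matrix (Fin d) (Fin d) ℝ)
    (CR : ℝ≥0) : Prop where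
  memLp_per : MemLp Aper ∞ (cubeMeasure d 0)
  periodic_per : AEPeriodic 0 Aper
  memLp_one : MemLp (fun z : E d × Ω => A₁ z.1 z.2) ∞ ((cubeMeasure d 0).prod P)
  stationary_one : Stationary P A₁
  tendsto_zero : Tendsto (fun η : ℝ => normInf P (fun x ω => A η x ω - Aper x))
    (𝓝[≠] 0) (𝓝 0)
  tendsto_one : Tendsto
    (fun η : ℝ => normInf P (fun x ω => η⁻¹ • (A η x ω - Aper x) - A₁ x ω)) (𝓝[≠] 0) (𝓝 0)
  remainder_le : ∀ η : ℝ, η ≠ 0 → |η| ≤ 1 →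
    ENNReal.ofReal ((η ^ 2)⁻¹) * normInf P (fun x ω => A η x ω - Aper x - η • A₁ x ω) ≤ CR

end WeakHom

open WeakHom

end

/-! Write `a = A_η`, `b = A_per`, `c = A_1`. Subtracting the equations of orders zero and one from
the equation for `w^η` shows that the error `z = ∇w^η - ∇w⁰ - η ∇w¹` solves an elliptic equation
with the same matrix `a` and source `(a - b - η c)(p + ∇w⁰) + η (a - b) ∇w¹`. The first coefficient
is `O(η²)` by the bound on the remainder. So is the second, since `a - b` is itself `O(η)`.
Coercivity gives `‖z‖ ≤ γ⁻¹ ‖source‖` in `L²(Q_N)`, and the same energy estimate bounds `∇w⁰` and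
`∇w¹` by `√|Q_N|` times constants that depend only on `γ` and on the sup norms. This is
`IsPerturbation.l2norm_error_le`. An entry of the matrix error is the mean over `Q_N` of a component
of `a z + source`, so Cauchy–Schwarz yields a second `√|Q_N|` and the volume cancels
(`IsPerturbation.abs_entry_le`).

Three facts support this. The corrector `w⁰` is posed on `Q` but must be tested on `Q_N`: summing
the translates of a test function over the unit cells turns it into a test function on `Q`
(`IsH1Per.cellSum`, `IsCorrector.of_unit`). Existence is Lax–Milgram in the closure of the smooth
periodic gradients, and the Poincaré–Wirtinger inequality shows that every element of this closure
is the gradient of an `H¹_per` function (`exists_isH1Per_of_mem`). Finally, bounds known on `Q × Ω`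
hold almost surely on all of `ℝ^d` by stationarity, the invariance of `P` and the countability of
`ℤ^d` (`Stationary.ae_ae`). Coercivity passes from `A_η` to `A_per` as `η → 0`. -/

namespace WeakHom

/-! ### Cubes and the lattice of periods -/

/-- The half-open cube of side `2 N + 1` centred at `y`. -/
def boxAt {d : ℕ} (N : ℕ) (y : E d) : Set (E d) :=
  {x | ∀ i, x i ∈ Set.Ico (y i - N - 1 / 2) (y i + N + 1 / 2)}

@[simp] lemma intVec_apply {d : ℕ} (k : Fin d → ℤ) (i : Fin d) : intVec k i = (k i : ℝ) := rfl

@[simp] lemma intVec_zero {d : ℕ} : intVec (0 : Fin d → ℤ) = 0 := by ext i; simp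

lemma intVec_add {d : ℕ} (k l : Fin d → ℤ) : intVec (k + l) = intVec k + intVec l := by
  ext i; simp

lemma intVec_neg {d : ℕ} (k : Fin d → ℤ) : intVec (-k) = -intVec k := by
  ext i; simp

lemma boxAt_eq_preimage {d : ℕ} (N : ℕ) (y : E d) :
    boxAt N y = WithLp.ofLp ⁻¹'
      (Set.univ.pi fun i => Set.Ico (y i - N - 1 / 2) (y i + N + 1 / 2)) := by
  ext x; simp [boxAt, Set.mem_pi]

lemma cube_eq_preimage (d N : ℕ) :
    cube d N = WithLp.ofLp ⁻¹'
      (Set.Icc (fun _ : Fin d => -(N : ℝ) - 1 / 2) (fun _ => (N : ℝ) + 1 / 2)) := by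
  ext x; simp [cube, Pi.le_def, forall_and]

lemma measurableSet_boxAt {d : ℕ} (N : ℕ) (y : E d) : MeasurableSet (boxAt N y) := by
  rw [boxAt_eq_preimage]
  exact (PiLp.volume_preserving_ofLp (Fin d)).measurable
    (MeasurableSet.univ_pi fun i => measurableSet_Ico)

lemma measurableSet_cube (d N : ℕ) : MeasurableSet (cube d N) := by
  rw [cube_eq_preimage]
  exact (PiLp.volume_preserving_ofLp (Fin d)).measurable measurableSet_Icc

lemma boxAt_ae_eq_cube (d N : ℕ) : boxAt N (0 : E d) =ᵐ[volume] cube d N := by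
  rw [boxAt_eq_preimage, cube_eq_preimage]
  refine (PiLp.volume_preserving_ofLp (Fin d)).quasiMeasurePreserving.preimage_ae_eq ?_
  rw [volume_pi]
  simpa using Measure.univ_pi_Ico_ae_eq_Icc (μ := fun _ : Fin d => (volume : Measure ℝ))
    (f := fun _ => -(N : ℝ) - 1 / 2) (g := fun _ => (N : ℝ) + 1 / 2)

lemma cubeMeasure_eq_restrict_boxAt (d N : ℕ) :
    cubeMeasure d N = volume.restrict (boxAt N (0 : E d)) :=
  Measure.restrict_congr_set (boxAt_ae_eq_cube d N).symm

lemma volume_cube (d N : ℕ) : volume (cube d N) = ENNReal.ofReal (2 * N + 1) ^ d := by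
  rw [cube_eq_preimage, (PiLp.volume_preserving_ofLp (Fin d)).measure_preimage
    measurableSet_Icc.nullMeasurableSet, Real.volume_Icc_pi]
  simp only [Finset.prod_const, Finset.card_univ, Fintype.card_fin]
  congr 2; ring

lemma volume_cube_ne_top (d N : ℕ) : volume (cube d N) ≠ ∞ := by
  rw [volume_cube]; exact ENNReal.pow_ne_top ENNReal.ofReal_ne_top

lemma volume_cube_ne_zero (d N : ℕ) : volume (cube d N) ≠ 0 := by
  rw [volume_cube]
  exact pow_ne_zero _ (by simp only [ne_eq, ENNReal.ofReal_eq_zero, not_le]; positivity)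

instance isFiniteMeasure_cubeMeasure (d N : ℕ) : IsFiniteMeasure (cubeMeasure d N) :=
  ⟨by simpa using (volume_cube_ne_top d N).lt_top⟩

lemma volume_real_cube (d N : ℕ) : volume.real (cube d N) = (2 * (N : ℝ) + 1) ^ d := by
  rw [measureReal_def, volume_cube, ENNReal.toReal_pow, ENNReal.toReal_ofReal (by positivity)]

lemma isCompact_cube (d N : ℕ) : IsCompact (cube d N) := by
  rw [cube_eq_preimage]
  exact (PiLp.homeomorph 2 (fun _ : Fin d => ℝ)).isCompact_preimage.mpr isCompact_Icc

/-- The lattice `(2 N + 1) ℤ^d` of periods. -/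
def periodLattice (d N : ℕ) : AddSubgroup (E d) where
  carrier := Set.range fun k : Fin d → ℤ => (2 * (N : ℝ) + 1) • intVec k
  add_mem' := by
    rintro _ _ ⟨k, rfl⟩ ⟨l, rfl⟩
    exact ⟨k + l, by simp [intVec_add]⟩
  zero_mem' := ⟨0, by simp⟩
  neg_mem' := by
    rintro _ ⟨k, rfl⟩
    exact ⟨-k, by simp [intVec_neg]⟩

instance countable_periodLattice (d N : ℕ) : Countable (periodLattice d N) :=
  (Set.countable_range _).to_subtype

lemma existsUnique_add_period_mem_boxAt {d : ℕ} (N : ℕ) (x y : E d) :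
    ∃! k : Fin d → ℤ, x + (2 * (N : ℝ) + 1) • intVec k ∈ boxAt N y := by
  have h : ∀ i, ∃! m : ℤ, x i + (2 * (N : ℝ) + 1) * m ∈
      Set.Ico (y i - N - 1 / 2) (y i + N + 1 / 2) := by
    intro i
    have := existsUnique_add_zsmul_mem_Ico (a := 2 * (N : ℝ) + 1) (by positivity) (x i)
      (y i - N - 1 / 2)
    rw [show y i - N - 1 / 2 + (2 * (N : ℝ) + 1) = y i + N + 1 / 2 by ring] at this
    simpa only [zsmul_eq_mul, mul_comm] using this
  choose k hk hu using h
  refine ⟨k, fun i => by simpa using hk i, fun l hl => ?_⟩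
  funext i
  exact hu i (l i) (by simpa using hl i)

/-- The centre `y` is arbitrary: a periodic function has the same integral over any two fundamental
domains, hence over a cube and its translates. -/
lemma isAddFundamentalDomain_boxAt {d : ℕ} (N : ℕ) (y : E d) :
    IsAddFundamentalDomain (periodLattice d N) (boxAt N y) volume := by
  refine IsAddFundamentalDomain.mk' (measurableSet_boxAt N y).nullMeasurableSet fun x => ?_
  obtain ⟨k, hk, hu⟩ := existsUnique_add_period_mem_boxAt N x y
  refine ⟨⟨_, k, rfl⟩, ?_, ?_⟩
  · simpa [AddSubgroup.vadd_def, add_comm] using hk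
  · rintro ⟨_, l, rfl⟩ hl
    have : l = k := hu l (by simpa [AddSubgroup.vadd_def, add_comm] using hl)
    simp [this]

lemma Periodic.vadd {d N : ℕ} {β : Type*} {f : E d → β} (hf : Periodic N f)
    (g : periodLattice d N) (x : E d) : f (g +ᵥ x) = f x := by
  obtain ⟨_, k, rfl⟩ := g
  have := hf k x
  simpa [AddSubgroup.vadd_def, add_comm] using this

lemma preimage_add_boxAt {d : ℕ} (N : ℕ) (h y : E d) :
    (fun x => x + h) ⁻¹' boxAt N (y + h) = boxAt N y := by
  ext x
  simp only [boxAt, Set.mem_preimage, Set.mem_ofPred_eq, PiLp.add_apply, Set.mem_Ico]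
  refine forall_congr' fun i => and_congr ?_ ?_ <;> constructor <;> intro <;> linarith

lemma measurePreserving_add_boxAt {d : ℕ} (N : ℕ) (h y : E d) :
    MeasurePreserving (fun x => x + h) (volume.restrict (boxAt N y))
      (volume.restrict (boxAt N (y + h))) := by
  have := (measurePreserving_add_right (volume : Measure (E d)) h).restrict_preimage
    (measurableSet_boxAt N (y + h))
  rwa [preimage_add_boxAt] at this

lemma Periodic.lintegral_add_right {d N : ℕ} {f : E d → ℝ≥0∞} (hf : Periodic N f) (h : E d) :
    ∫⁻ x in cube d N, f (x + h) = ∫⁻ x in cube d N, f x := by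
  change ∫⁻ x, f (x + h) ∂(cubeMeasure d N) = ∫⁻ x, f x ∂(cubeMeasure d N)
  rw [cubeMeasure_eq_restrict_boxAt,
    (measurePreserving_add_boxAt N h 0).lintegral_comp_emb (measurableEmbedding_addRight h) f]
  exact (isAddFundamentalDomain_boxAt N _).setLIntegral_eq (isAddFundamentalDomain_boxAt N _) f
    hf.vadd

lemma Periodic.integral_add_right {d N : ℕ} {F : Type*} [NormedAddCommGroup F] [NormedSpace ℝ F]
    {f : E d → F} (hf : Periodic N f) (h : E d) :
    ∫ x in cube d N, f (x + h) = ∫ x in cube d N, f x := by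
  change ∫ x, f (x + h) ∂(cubeMeasure d N) = ∫ x, f x ∂(cubeMeasure d N)
  rw [cubeMeasure_eq_restrict_boxAt,
    (measurePreserving_add_boxAt N h 0).integral_comp (measurableEmbedding_addRight h) f]
  exact (isAddFundamentalDomain_boxAt N _).setIntegral_eq (isAddFundamentalDomain_boxAt N _)
    hf.vadd

/-- A property that holds almost everywhere on all translates of `Q_N` by periods holds almost
everywhere. -/
lemma ae_of_forall_ae_cube_add {d : ℕ} (N : ℕ) {S : E d → Prop}
    (h : ∀ k : Fin d → ℤ, ∀ᵐ x ∂(cubeMeasure d N), S (x + (2 * (N : ℝ) + 1) • intVec k)) :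
    ∀ᵐ x : E d, S x := by
  have h' : ∀ k : Fin d → ℤ, ∀ᵐ x : E d, x - (2 * (N : ℝ) + 1) • intVec k ∈ boxAt N 0 → S x := by
    intro k
    have hk := h k
    rw [cubeMeasure_eq_restrict_boxAt, ae_restrict_iff' (measurableSet_boxAt N 0)] at hk
    have := (measurePreserving_sub_right (volume : Measure (E d))
      ((2 * (N : ℝ) + 1) • intVec k)).quasiMeasurePreserving.ae hk
    simpa using this
  filter_upwards [ae_all_iff.mpr h'] with x hx
  obtain ⟨k, hk, -⟩ := existsUnique_add_period_mem_boxAt N x 0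
  exact hx (-k) (by simpa [intVec_neg] using hk)

/-- Carries uniqueness of gradients from `Q_N`, where the energy estimate lives, to all of `ℝ^d`. -/
lemma AEPeriodic.ae_eq_of_ae_eq_cube {d N : ℕ} {β : Type*} {f g : E d → β} (hf : AEPeriodic N f)
    (hg : AEPeriodic N g) (h : f =ᵐ[cubeMeasure d N] g) : f =ᵐ[volume] g := by
  refine ae_of_forall_ae_cube_add N fun k => ?_
  filter_upwards [h, ae_restrict_of_ae (hf k), ae_restrict_of_ae (hg k)] with x h1 h2 h3
  rw [h2, h3, h1]

lemma Periodic.aePeriodic {d N : ℕ} {β : Type*} {f : E d → β} (hf : Periodic N f) :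
    AEPeriodic N f := fun k => Eventually.of_forall (hf k)

/-- The `Q_N`-periodic function that agrees with `f` on the half-open cube `Q_N`. -/
noncomputable def periodize {d : ℕ} {β : Type*} (N : ℕ) (f : E d → β) (x : E d) : β :=
  f (x + (2 * (N : ℝ) + 1) • intVec (existsUnique_add_period_mem_boxAt N x 0).choose)

lemma periodize_eq {d N : ℕ} {β : Type*} (f : E d → β) {x : E d} {k : Fin d → ℤ}
    (h : x + (2 * (N : ℝ) + 1) • intVec k ∈ boxAt N 0) :
    periodize N f x = f (x + (2 * (N : ℝ) + 1) • intVec k) := by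
  rw [periodize, ← (existsUnique_add_period_mem_boxAt N x 0).choose_spec.2 k h]

lemma periodic_periodize {d : ℕ} {β : Type*} (N : ℕ) (f : E d → β) :
    Periodic N (periodize N f) := by
  intro k x
  obtain ⟨l, hl, -⟩ := existsUnique_add_period_mem_boxAt N x 0
  have e : x + (2 * (N : ℝ) + 1) • intVec k + (2 * (N : ℝ) + 1) • intVec (l - k) =
      x + (2 * (N : ℝ) + 1) • intVec l := by
    rw [add_assoc, ← smul_add, ← intVec_add, add_sub_cancel]
  rw [periodize_eq f hl, periodize_eq f (k := l - k) (by rwa [e]), e]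

lemma periodize_ae_eq {d : ℕ} {β : Type*} (N : ℕ) (f : E d → β) :
    periodize N f =ᵐ[cubeMeasure d N] f := by
  rw [cubeMeasure_eq_restrict_boxAt]
  filter_upwards [ae_restrict_mem (measurableSet_boxAt N (0 : E d))] with x hx
  have : x + (2 * (N : ℝ) + 1) • intVec (0 : Fin d → ℤ) ∈ boxAt N 0 := by simpa using hx
  simpa using periodize_eq f this

/-! ### Decomposition of `Q_N` into unit cells -/

/-- The integer vector in `{-N, …, N}^d` that represents a class modulo `2 N + 1`. -/
def cellShift {d N : ℕ} (c : Fin d → ZMod (2 * N + 1)) : Fin d → ℤ :=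
  fun i => ((c i).val : ℤ) - N

/-- Indexing the cells by classes modulo `2 N + 1` makes an integer translation act on them as a
permutation, up to periods of `Q_N`. -/
lemma exists_cellShift_add {d N : ℕ} (c : Fin d → ZMod (2 * N + 1)) (k : Fin d → ℤ) :
    ∃ m : Fin d → ℤ, intVec (cellShift c + k) =
      intVec (cellShift (c + fun i => (k i : ZMod (2 * N + 1)))) +
        (2 * (N : ℝ) + 1) • intVec m := by
  have h : ∀ i, ∃ m : ℤ, cellShift c i + k i =
      cellShift (c + fun i => (k i : ZMod (2 * N + 1))) i + (2 * N + 1) * m := by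
    intro i
    have : ((2 * N + 1 : ℕ) : ℤ) ∣ (cellShift c i + k i) -
        cellShift (c + fun i => (k i : ZMod (2 * N + 1))) i := by
      rw [← ZMod.intCast_eq_intCast_iff_dvd_sub]
      simp only [cellShift]
      push_cast
      simp only [ZMod.natCast_val, ZMod.cast_id', id, Pi.add_apply]
      ring
    obtain ⟨m, hm⟩ := this
    exact ⟨m, by push_cast at hm; linarith⟩
  choose m hm using h
  refine ⟨m, ?_⟩
  ext i
  have := congrArg (Int.cast : ℤ → ℝ) (hm i)
  push_cast at this
  simpa using this

lemma boxAt_eq_iUnion {d : ℕ} (N : ℕ) :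
    boxAt N (0 : E d) =
      ⋃ c : Fin d → ZMod (2 * N + 1), boxAt 0 (intVec (cellShift c)) := by
  ext x
  simp only [boxAt, Set.mem_ofPred_eq, Set.mem_iUnion, Set.mem_Ico, intVec_apply, cellShift,
    PiLp.zero_apply]
  push_cast
  constructor
  · intro hx
    -- The floor counts unit cells from the left face `-N - 1/2`, hence lies in `{0, …, 2 N}`.
    have hfl : ∀ i, ∃ j : ℕ, j < 2 * N + 1 ∧ ⌊x i + N + 1 / 2⌋ = j := by
      intro i
      obtain ⟨h1, h2⟩ := hx i
      have h0 : 0 ≤ ⌊x i + N + 1 / 2⌋ := Int.floor_nonneg.mpr (by linarith)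
      obtain ⟨j, hj⟩ := Int.eq_ofNat_of_zero_le h0
      refine ⟨j, ?_, hj⟩
      have : ⌊x i + N + 1 / 2⌋ < ((2 * N + 1 : ℕ) : ℤ) :=
        Int.floor_lt.mpr (by push_cast; linarith)
      omega
    choose j hj hfl using hfl
    refine ⟨fun i => (j i : ZMod (2 * N + 1)), fun i => ?_⟩
    rw [ZMod.val_natCast_of_lt (hj i)]
    obtain ⟨h1, h2⟩ := Int.floor_eq_iff.mp (hfl i)
    push_cast at h1 h2
    constructor <;> linarith
  · rintro ⟨c, hc⟩ i
    obtain ⟨h1, h2⟩ := hc i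
    have h3 : ((c i).val : ℝ) ≤ 2 * N := by exact_mod_cast Nat.lt_succ_iff.mp (ZMod.val_lt (c i))
    have h4 : (0 : ℝ) ≤ ((c i).val : ℝ) := Nat.cast_nonneg _
    constructor <;> linarith

lemma pairwise_disjoint_boxAt_cellShift {d : ℕ} (N : ℕ) :
    Pairwise (Function.onFun Disjoint
      fun c : Fin d → ZMod (2 * N + 1) => boxAt 0 (intVec (cellShift c) : E d)) := by
  intro c c' hc
  refine Set.disjoint_left.mpr fun x hx hx' => hc ?_
  funext i
  have h := hx i
  have h' := hx' i
  simp only [intVec_apply, cellShift, Set.mem_Ico] at h h'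
  push_cast at h h'
  have h1 : ((c i).val : ℝ) < (c' i).val + 1 := by linarith
  have h2 : ((c' i).val : ℝ) < (c i).val + 1 := by linarith
  have h1' : (c i).val < (c' i).val + 1 := by exact_mod_cast h1
  have h2' : (c' i).val < (c i).val + 1 := by exact_mod_cast h2
  exact ZMod.val_injective _ (by omega)

/-- `Q_N` is, up to a null set, the disjoint union of `(2 N + 1)^d` translates of `Q`. -/
lemma cubeMeasure_eq_sum_map (d N : ℕ) :
    cubeMeasure d N = ∑ c : Fin d → ZMod (2 * N + 1),
      (cubeMeasure d 0).map (fun x => x + intVec (cellShift c)) := by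
  rw [cubeMeasure_eq_restrict_boxAt d N, boxAt_eq_iUnion,
    Measure.restrict_iUnion (pairwise_disjoint_boxAt_cellShift N)
      (fun c => measurableSet_boxAt 0 _), Measure.sum_fintype]
  refine Finset.sum_congr rfl fun c _ => ?_
  rw [cubeMeasure_eq_restrict_boxAt d 0,
    (measurePreserving_add_boxAt 0 (intVec (cellShift c)) 0).map_eq, zero_add]

lemma lintegral_cube_eq_sum {d : ℕ} (N : ℕ) (f : E d → ℝ≥0∞) :
    ∫⁻ x in cube d N, f x =
      ∑ c : Fin d → ZMod (2 * N + 1), ∫⁻ x in cube d 0, f (x + intVec (cellShift c)) := by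
  change ∫⁻ x, f x ∂(cubeMeasure d N) = _
  rw [cubeMeasure_eq_sum_map, lintegral_finsetSum_measure]
  exact Finset.sum_congr rfl fun c _ =>
    (measurableEmbedding_addRight (intVec (cellShift c))).lintegral_map _

lemma map_add_cellShift_le {d N : ℕ} (c : Fin d → ZMod (2 * N + 1)) :
    (cubeMeasure d 0).map (fun x => x + intVec (cellShift c)) ≤ cubeMeasure d N := by
  rw [cubeMeasure_eq_sum_map d N]
  exact Finset.single_le_sum (f := fun c : Fin d → ZMod (2 * N + 1) =>
    (cubeMeasure d 0).map (fun x => x + intVec (cellShift c))) (fun _ _ => Measure.zero_le _)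
    (Finset.mem_univ c)

lemma integral_cube_eq_sum {d : ℕ} {F : Type*} [NormedAddCommGroup F] [NormedSpace ℝ F] (N : ℕ)
    {f : E d → F} (hf : Integrable f (cubeMeasure d N)) :
    ∫ x in cube d N, f x =
      ∑ c : Fin d → ZMod (2 * N + 1), ∫ x in cube d 0, f (x + intVec (cellShift c)) := by
  change ∫ x, f x ∂(cubeMeasure d N) = _
  have hc : ∀ c : Fin d → ZMod (2 * N + 1),
      Integrable f ((cubeMeasure d 0).map (fun x => x + intVec (cellShift c))) := fun c =>
    hf.mono_measure (map_add_cellShift_le c)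
  rw [cubeMeasure_eq_sum_map, integral_finsetSum_measure (fun c _ => hc c)]
  exact Finset.sum_congr rfl fun c _ =>
    (measurableEmbedding_addRight (intVec (cellShift c))).integral_map _

/-! ### The space `H¹_per(Q_N)` -/

lemma continuous_gradient {d : ℕ} {φ : E d → ℝ} (hφ : ContDiff ℝ (⊤ : ℕ∞) φ) :
    Continuous (gradient φ) :=
  (InnerProductSpace.toDual ℝ (E d)).symm.continuous.comp
    (hφ.continuous_fderiv (by simp))

lemma gradient_add {d : ℕ} {φ φ' : E d → ℝ} (hφ : ContDiff ℝ (⊤ : ℕ∞) φ)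
    (hφ' : ContDiff ℝ (⊤ : ℕ∞) φ') (x : E d) :
    gradient (fun y => φ y + φ' y) x = gradient φ x + gradient φ' x := by
  rw [gradient, fderiv_fun_add (hφ.differentiable (by simp) x) (hφ'.differentiable (by simp) x),
    map_add]
  rfl

lemma gradient_const_smul {d : ℕ} {φ : E d → ℝ} (hφ : ContDiff ℝ (⊤ : ℕ∞) φ) (c : ℝ) (x : E d) :
    gradient (fun y => c * φ y) x = c • gradient φ x := by
  rw [gradient, fderiv_const_mul (hφ.differentiable (by simp) x), gradient]
  simp

lemma gradient_comp_add_right {d : ℕ} (φ : E d → ℝ) (h x : E d) :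
    gradient (fun y => φ (y + h)) x = gradient φ (x + h) := by
  rw [gradient, fderiv_comp_add_right, gradient]

lemma gradient_sum {d : ℕ} {ι : Type*} (s : Finset ι) {φ : ι → E d → ℝ}
    (hφ : ∀ i, ContDiff ℝ (⊤ : ℕ∞) (φ i)) (x : E d) :
    gradient (fun y => ∑ i ∈ s, φ i y) x = ∑ i ∈ s, gradient (φ i) x := by
  simp only [gradient]
  rw [fderiv_fun_sum (fun i _ => (hφ i).differentiable (by simp) x), map_sum]

lemma gradient_add_const {d : ℕ} (φ : E d → ℝ) (c : ℝ) (x : E d) :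
    gradient (fun y => φ y - c) x = gradient φ x := by
  rw [gradient, fderiv_sub_const, gradient]

lemma Periodic.gradient {d N : ℕ} {φ : E d → ℝ} (hφ : Periodic N φ) :
    Periodic N (gradient φ) := by
  intro k x
  rw [← gradient_comp_add_right]
  congr 1
  funext y
  exact hφ k y

lemma memLp_cube_of_continuous {d N : ℕ} {F : Type*} [NormedAddCommGroup F] {f : E d → F}
    (hf : Continuous f) (p : ℝ≥0∞) : MemLp f p (cubeMeasure d N) := by
  have : SecondCountableTopologyEither (E d) F := inferInstance
  obtain ⟨C, hC⟩ := (isCompact_cube d N).exists_bound_of_continuousOn hf.continuousOn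
  refine MemLp.of_bound hf.aestronglyMeasurable C ?_
  filter_upwards [ae_restrict_mem (measurableSet_cube d N)] with x hx using hC x hx

/-- Common form of the approximation arguments below. The two measures may differ, which allows
passing between `Q` and `Q_N`; `c' = 0` is the case of a single sequence. -/
lemma tendsto_eLpNorm_zero_of_le_add {α β γ δ : Type*} [MeasurableSpace α] {μ ν : Measure α}
    [NormedAddCommGroup β] [NormedAddCommGroup γ] [NormedAddCommGroup δ]
    {u : ℕ → α → β} {v : ℕ → α → γ} {w : ℕ → α → δ} {c c' : ℝ≥0∞} (hc : c ≠ ∞) (hc' : c' ≠ ∞)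
    (hu : Tendsto (fun n => eLpNorm (u n) 2 μ) atTop (𝓝 0))
    (hv : Tendsto (fun n => eLpNorm (v n) 2 μ) atTop (𝓝 0))
    (h : ∀ n, eLpNorm (w n) 2 ν ≤ c * eLpNorm (u n) 2 μ + c' * eLpNorm (v n) 2 μ) :
    Tendsto (fun n => eLpNorm (w n) 2 ν) atTop (𝓝 0) := by
  have := (ENNReal.Tendsto.const_mul hu (Or.inr hc)).add
    (ENNReal.Tendsto.const_mul hv (Or.inr hc'))
  simp only [mul_zero, add_zero] at this
  exact tendsto_of_tendsto_of_tendsto_of_le_of_le tendsto_const_nhds this (fun _ => zero_le) h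

lemma IsH1Per.add_smul {d N : ℕ} {w w' : E d → ℝ} {g g' : E d → E d} (h : IsH1Per N w g)
    (h' : IsH1Per N w' g') (c : ℝ) :
    IsH1Per N (fun x => w x + c * w' x) (fun x => g x + c • g' x) := by
  obtain ⟨φ, hφ1, hφ2, hφ3, hφ4⟩ := h.exists_approx
  obtain ⟨φ', hφ1', hφ2', hφ3', hφ4'⟩ := h'.exists_approx
  refine ⟨h.memLp_fun.add (h'.memLp_fun.const_mul c), h.memLp_grad.add (h'.memLp_grad.const_smul c),
    fun k => ?_, fun k => ?_, fun n x => φ n x + c * φ' n x, fun n => ?_, fun n k x => ?_, ?_, ?_⟩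
  · filter_upwards [h.periodic_fun k, h'.periodic_fun k] with x h1 h2
    rw [h1, h2]
  · filter_upwards [h.periodic_grad k, h'.periodic_grad k] with x h1 h2
    rw [h1, h2]
  · exact (hφ1 n).add (contDiff_const.mul (hφ1' n))
  · simp only [hφ2 n k x, hφ2' n k x]
  · refine tendsto_eLpNorm_zero_of_le_add (c := 1) (c' := ‖c‖ₑ) (by simp) (by simp) hφ3 hφ3'
      fun n => ?_
    have e : (fun x => φ n x + c * φ' n x - (w x + c * w' x)) =
        (fun x => φ n x - w x) + c • (fun x => φ' n x - w' x) := by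
      funext x; simp; ring
    rw [e, one_mul, ← eLpNorm_const_smul]
    exact eLpNorm_add_le
      ((hφ1 n).continuous.aestronglyMeasurable.sub h.memLp_fun.aestronglyMeasurable)
      (((hφ1' n).continuous.aestronglyMeasurable.sub
        h'.memLp_fun.aestronglyMeasurable).const_smul c) (by norm_num)
  · refine tendsto_eLpNorm_zero_of_le_add (c := 1) (c' := ‖c‖ₑ) (by simp) (by simp) hφ4 hφ4'
      fun n => ?_
    have e : (fun x => gradient (fun x => φ n x + c * φ' n x) x - (g x + c • g' x)) =
        (fun x => gradient (φ n) x - g x) + c • (fun x => gradient (φ' n) x - g' x) := by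
      funext x
      rw [gradient_add (hφ1 n) (contDiff_const.mul (hφ1' n)), gradient_const_smul (hφ1' n)]
      simp only [Pi.add_apply, Pi.smul_apply]
      module
    rw [e, one_mul, ← eLpNorm_const_smul]
    exact eLpNorm_add_le
      ((continuous_gradient (hφ1 n)).aestronglyMeasurable.sub h.memLp_grad.aestronglyMeasurable)
      (((continuous_gradient (hφ1' n)).aestronglyMeasurable.sub
        h'.memLp_grad.aestronglyMeasurable).const_smul c) (by norm_num)

lemma IsH1Per.sub {d N : ℕ} {w w' : E d → ℝ} {g g' : E d → E d} (h : IsH1Per N w g)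
    (h' : IsH1Per N w' g') : IsH1Per N (fun x => w x - w' x) (fun x => g x - g' x) := by
  simpa [sub_eq_add_neg] using h.add_smul h' (-1)

/-! ### From the unit cell to `Q_N` -/

lemma intVec_nsmul_add_one {d : ℕ} (N : ℕ) (k : Fin d → ℤ) :
    intVec ((2 * N + 1 : ℤ) • k) = (2 * (N : ℝ) + 1) • intVec k := by
  ext i; simp

lemma AEPeriodic.of_unit {d : ℕ} {β : Type*} (N : ℕ) {f : E d → β} (hf : AEPeriodic 0 f) :
    AEPeriodic N f := by
  intro k
  have := hf ((2 * N + 1 : ℤ) • k)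
  simpa only [intVec_nsmul_add_one, Nat.cast_zero, mul_zero, zero_add, one_smul] using this

lemma Periodic.of_unit {d : ℕ} {β : Type*} (N : ℕ) {f : E d → β} (hf : Periodic 0 f) :
    Periodic N f := by
  intro k x
  have := hf ((2 * N + 1 : ℤ) • k) x
  simpa only [intVec_nsmul_add_one, Nat.cast_zero, mul_zero, zero_add, one_smul] using this

lemma AEPeriodic.ae_add_intVec {d : ℕ} {β : Type*} {f : E d → β} (hf : AEPeriodic 0 f)
    (k : Fin d → ℤ) : ∀ᵐ x : E d, f (x + intVec k) = f x := by
  simpa using hf k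

lemma eLpNorm_two_eq {α β : Type*} [MeasurableSpace α] (μ : Measure α) [NormedAddCommGroup β]
    (f : α → β) : eLpNorm f 2 μ = (∫⁻ x, ‖f x‖ₑ ^ 2 ∂μ) ^ (1 / 2 : ℝ) := by
  rw [eLpNorm_eq_lintegral_rpow_enorm_toReal (by norm_num) (by norm_num)]
  simp

lemma AEPeriodic.eLpNorm_cube {d : ℕ} {F : Type*} [NormedAddCommGroup F] (N : ℕ) {f : E d → F}
    (hf : AEPeriodic 0 f) : eLpNorm f 2 (cubeMeasure d N) =
      (Fintype.card (Fin d → ZMod (2 * N + 1)) : ℝ≥0∞) ^ (1 / 2 : ℝ) *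
        eLpNorm f 2 (cubeMeasure d 0) := by
  rw [eLpNorm_two_eq, eLpNorm_two_eq, lintegral_cube_eq_sum,
    ← ENNReal.mul_rpow_of_nonneg _ _ (by norm_num : (0 : ℝ) ≤ 1 / 2)]
  congr 1
  rw [Finset.sum_congr rfl (g := fun _ => ∫⁻ x in cube d 0, ‖f x‖ₑ ^ 2)]
  · simp
  · intro c _
    refine lintegral_congr_ae (ae_restrict_of_ae ?_)
    filter_upwards [hf.ae_add_intVec (cellShift c)] with x hx
    rw [hx]

lemma AEPeriodic.aestronglyMeasurable_cube {d : ℕ} {F : Type*} [TopologicalSpace F]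
    [TopologicalSpace.PseudoMetrizableSpace F] (N : ℕ)
    {f : E d → F} (hf : AEPeriodic 0 f) (h : AEStronglyMeasurable f (cubeMeasure d 0)) :
    AEStronglyMeasurable f (cubeMeasure d N) := by
  rw [cubeMeasure_eq_sum_map, ← Measure.sum_fintype, aestronglyMeasurable_sum_measure_iff]
  intro c
  rw [(measurableEmbedding_addRight (intVec (cellShift c))).aestronglyMeasurable_map_iff]
  refine h.congr (ae_restrict_of_ae ?_)
  filter_upwards [hf.ae_add_intVec (cellShift c)] with x hx
  simp [hx]

lemma AEPeriodic.memLp_cube {d : ℕ} {F : Type*} [NormedAddCommGroup F] (N : ℕ) {f : E d → F}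
    (hf : AEPeriodic 0 f) (h : MemLp f 2 (cubeMeasure d 0)) : MemLp f 2 (cubeMeasure d N) := by
  refine ⟨hf.aestronglyMeasurable_cube N h.1, ?_⟩
  rw [hf.eLpNorm_cube]
  exact ENNReal.mul_lt_top
    (ENNReal.rpow_lt_top_of_nonneg (by norm_num) (ENNReal.natCast_ne_top _)) h.2

/-- The same smooth approximants serve on `Q_N`, because the `L²` norm of a `ℤ^d`-periodic function
is only multiplied by the square root of the number of cells. -/
lemma IsH1Per.of_unit {d : ℕ} (N : ℕ) {w : E d → ℝ} {g : E d → E d} (h : IsH1Per 0 w g) :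
    IsH1Per N w g := by
  obtain ⟨φ, hφ1, hφ2, hφ3, hφ4⟩ := h.exists_approx
  have hc : (Fintype.card (Fin d → ZMod (2 * N + 1)) : ℝ≥0∞) ^ (1 / 2 : ℝ) ≠ ∞ :=
    (ENNReal.rpow_lt_top_of_nonneg (by norm_num) (ENNReal.natCast_ne_top _)).ne
  refine ⟨h.periodic_fun.memLp_cube N h.memLp_fun, h.periodic_grad.memLp_cube N h.memLp_grad,
    h.periodic_fun.of_unit N, h.periodic_grad.of_unit N, φ, hφ1, fun n => (hφ2 n).of_unit N,
    ?_, ?_⟩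
  · refine tendsto_eLpNorm_zero_of_le_add (c' := 0) hc (by simp) hφ3 hφ3 fun n => ?_
    rw [zero_mul, add_zero, AEPeriodic.eLpNorm_cube N fun k => ?_]
    filter_upwards [h.periodic_fun k] with x hx
    rw [hφ2 n k x, hx]
  · refine tendsto_eLpNorm_zero_of_le_add (c' := 0) hc (by simp) hφ4 hφ4 fun n => ?_
    rw [zero_mul, add_zero, AEPeriodic.eLpNorm_cube N fun k => ?_]
    filter_upwards [h.periodic_grad k] with x hx
    rw [(hφ2 n).gradient k x, hx]

/-- The sum of the translates of `f` by representatives of the integer vectors modulo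
`2 N + 1`. -/
def cellSum {d : ℕ} {F : Type*} [AddCommMonoid F] (N : ℕ) (f : E d → F) (x : E d) : F :=
  ∑ c : Fin d → ZMod (2 * N + 1), f (x + intVec (cellShift c))

/-- An integer translation permutes the terms modulo periods. The hypothesis is pointwise at `x`, so
that it serves both exact and almost everywhere periodicity. -/
lemma cellSum_add_intVec {d N : ℕ} {F : Type*} [AddCommMonoid F] {f : E d → F} {x : E d}
    (hx : ∀ l m : Fin d → ℤ, f (x + intVec l + (2 * (N : ℝ) + 1) • intVec m) = f (x + intVec l))
    (k : Fin d → ℤ) : cellSum N f (x + intVec k) = cellSum N f x := by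
  refine Fintype.sum_equiv (Equiv.addRight fun i => (k i : ZMod (2 * N + 1))) _ _ fun c => ?_
  obtain ⟨m, hm⟩ := exists_cellShift_add c k
  rw [Equiv.coe_addRight, ← hx _ m, add_assoc _ (intVec k), add_comm (intVec k), ← intVec_add, hm,
    ← add_assoc]

lemma Periodic.cellSum {d N : ℕ} {F : Type*} [AddCommMonoid F] {f : E d → F}
    (hf : Periodic N f) : Periodic 0 (cellSum N f) := by
  intro k x
  simpa using cellSum_add_intVec (fun l m => hf m (x + intVec l)) k

lemma AEPeriodic.cellSum {d N : ℕ} {F : Type*} [AddCommMonoid F] {f : E d → F}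
    (hf : AEPeriodic N f) : AEPeriodic 0 (cellSum N f) := by
  intro k
  have h : ∀ᵐ x : E d, ∀ l m : Fin d → ℤ,
      f (x + intVec l + (2 * (N : ℝ) + 1) • intVec m) = f (x + intVec l) := by
    rw [ae_all_iff]; intro l
    rw [ae_all_iff]; intro m
    exact (measurePreserving_add_right (volume : Measure (E d))
      (intVec l)).quasiMeasurePreserving.ae (hf m)
  filter_upwards [h] with x hx
  simpa using cellSum_add_intVec hx k

lemma memLp_comp_add_cellShift {d N : ℕ} {F : Type*} [NormedAddCommGroup F] {f : E d → F}
    {p : ℝ≥0∞} (hf : MemLp f p (cubeMeasure d N)) (c : Fin d → ZMod (2 * N + 1)) :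
    MemLp (fun x => f (x + intVec (cellShift c))) p (cubeMeasure d 0) :=
  (measurableEmbedding_addRight (intVec (cellShift c))).memLp_map_measure_iff.mp
    (hf.mono_measure (map_add_cellShift_le c))

lemma eLpNorm_cellSum_le {d N : ℕ} {F : Type*} [NormedAddCommGroup F] {f : E d → F}
    (hf : MemLp f 2 (cubeMeasure d N)) : eLpNorm (cellSum N f) 2 (cubeMeasure d 0) ≤
      (Fintype.card (Fin d → ZMod (2 * N + 1)) : ℝ≥0∞) * eLpNorm f 2 (cubeMeasure d N) := by
  have e : cellSum N f = ∑ c : Fin d → ZMod (2 * N + 1),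
      fun x => f (x + intVec (cellShift c)) := by
    funext x; simp [cellSum]
  rw [e]
  refine (eLpNorm_sum_le (fun c _ => (memLp_comp_add_cellShift hf c).1) (by norm_num)).trans ?_
  refine (Finset.sum_le_card_nsmul _ _ (eLpNorm f 2 (cubeMeasure d N)) fun c _ => ?_).trans ?_
  · refine ((measurableEmbedding_addRight
      (intVec (cellShift c))).eLpNorm_map_measure (g := f)).symm.trans_le ?_
    exact eLpNorm_mono_measure f (map_add_cellShift_le c)
  · simp

lemma memLp_cellSum {d N : ℕ} {F : Type*} [NormedAddCommGroup F] {f : E d → F} {p : ℝ≥0∞}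
    (hf : MemLp f p (cubeMeasure d N)) : MemLp (cellSum N f) p (cubeMeasure d 0) :=
  memLp_finsetSum _ fun c _ => memLp_comp_add_cellShift hf c

lemma cellSum_sub {d N : ℕ} {F : Type*} [AddCommGroup F] (f g : E d → F) (x : E d) :
    cellSum N (fun x => f x - g x) x = cellSum N f x - cellSum N g x := by
  simp [cellSum]

/-- Folding commutes with the gradient on smooth functions and is bounded from `L²(Q_N)` to `L²(Q)`,
so it passes to the closure. -/
lemma IsH1Per.cellSum {d N : ℕ} {w : E d → ℝ} {g : E d → E d} (h : IsH1Per N w g) :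
    IsH1Per 0 (cellSum N w) (cellSum N g) := by
  obtain ⟨φ, hφ1, hφ2, hφ3, hφ4⟩ := h.exists_approx
  have hs : ∀ n (c : Fin d → ZMod (2 * N + 1)),
      ContDiff ℝ (⊤ : ℕ∞) (fun x => φ n (x + intVec (cellShift c))) :=
    fun n c => (hφ1 n).comp (contDiff_id.add contDiff_const)
  refine ⟨memLp_cellSum h.memLp_fun, memLp_cellSum h.memLp_grad, h.periodic_fun.cellSum,
    h.periodic_grad.cellSum, fun n => WeakHom.cellSum N (φ n), fun n => ?_,
    fun n => (hφ2 n).cellSum, ?_, ?_⟩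
  · exact ContDiff.sum fun c _ => hs n c
  · refine tendsto_eLpNorm_zero_of_le_add (c' := 0)
      (c := (Fintype.card (Fin d → ZMod (2 * N + 1)) : ℝ≥0∞)) (ENNReal.natCast_ne_top _)
      (by simp) hφ3 hφ3
      fun n => ?_
    rw [zero_mul, add_zero]
    simp only [← cellSum_sub]
    exact eLpNorm_cellSum_le ((memLp_cube_of_continuous (hφ1 n).continuous 2).sub h.memLp_fun)
  · refine tendsto_eLpNorm_zero_of_le_add (c' := 0)
      (c := (Fintype.card (Fin d → ZMod (2 * N + 1)) : ℝ≥0∞)) (ENNReal.natCast_ne_top _)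
      (by simp) hφ4 hφ4
      fun n => ?_
    rw [zero_mul, add_zero]
    have e : ∀ x, gradient (WeakHom.cellSum N (φ n)) x =
        WeakHom.cellSum N (gradient (φ n)) x := by
      intro x
      unfold WeakHom.cellSum
      rw [gradient_sum _ (hs n)]
      simp only [gradient_comp_add_right]
    simp only [e, ← cellSum_sub]
    exact eLpNorm_cellSum_le
      ((memLp_cube_of_continuous (continuous_gradient (hφ1 n)) 2).sub h.memLp_grad)

lemma integrable_inner {α : Type*} [MeasurableSpace α] {μ : Measure α} {d : ℕ} {f g : α → E d}
    (hf : MemLp f 2 μ) (hg : MemLp g 2 μ) : Integrable (fun x => inner ℝ (f x) (g x)) μ :=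
  (L2.integrable_inner (𝕜 := ℝ) (hf.toLp f) (hg.toLp g)).congr <| by
    filter_upwards [hf.coeFn_toLp, hg.coeFn_toLp] with x h1 h2
    rw [h1, h2]

/-- A `ℤ^d`-periodic field that is orthogonal to the gradients on `Q` is orthogonal to the
gradients on `Q_N`. -/
lemma integral_inner_cube_eq_zero_of_unit {d N : ℕ} {F : E d → E d} (hF : AEPeriodic 0 F)
    (hF2 : MemLp F 2 (cubeMeasure d 0))
    (h : ∀ φ ψ, IsH1Per 0 φ ψ → ∫ x in cube d 0, inner ℝ (F x) (ψ x) = 0)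
    {φ : E d → ℝ} {ψ : E d → E d} (hφ : IsH1Per N φ ψ) :
    ∫ x in cube d N, inner ℝ (F x) (ψ x) = 0 := by
  rw [integral_cube_eq_sum N (integrable_inner (hF.memLp_cube N hF2) hφ.memLp_grad),
    ← h _ _ hφ.cellSum]
  -- On each cell the field `F` repeats itself and only the test gradient is translated, so the sum
  -- over cells pairs `F` with the folded test gradient.
  have e : ∀ c : Fin d → ZMod (2 * N + 1),
      ∫ x in cube d 0, inner ℝ (F (x + intVec (cellShift c))) (ψ (x + intVec (cellShift c))) =
        ∫ x in cube d 0, inner ℝ (F x) (ψ (x + intVec (cellShift c))) := by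
    intro c
    refine integral_congr_ae (ae_restrict_of_ae ?_)
    filter_upwards [hF.ae_add_intVec (cellShift c)] with x hx
    rw [hx]
  simp only [e]
  rw [← integral_finsetSum _ fun c _ =>
    integrable_inner hF2 (memLp_comp_add_cellShift hφ.memLp_grad c)]
  simp only [cellSum, inner_sum]

/-- The integral over `Q_N` of a `ℤ^d`-periodic function. -/
lemma AEPeriodic.integral_cube {d : ℕ} (N : ℕ) {f : E d → ℝ} (hf : AEPeriodic 0 f)
    (hi : Integrable f (cubeMeasure d N)) :
    (volume.real (cube d N))⁻¹ * ∫ x in cube d N, f x =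
      (volume.real (cube d 0))⁻¹ * ∫ x in cube d 0, f x := by
  rw [integral_cube_eq_sum N hi, Finset.sum_congr rfl (g := fun _ => ∫ x in cube d 0, f x)]
  · rw [volume_real_cube, volume_real_cube]
    have : (2 * (N : ℝ) + 1) ^ d ≠ 0 := by positivity
    simp [this]
  · intro c _
    refine integral_congr_ae (ae_restrict_of_ae ?_)
    filter_upwards [hf.ae_add_intVec (cellShift c)] with x hx using hx

/-! ### The Poincaré–Wirtinger inequality for smooth periodic functions -/

/-- Jensen's inequality, here the monotonicity of `L^p` norms for a probability measure. -/
lemma enorm_integral_sq_le {α F : Type*} [MeasurableSpace α] {μ : Measure α}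
    [IsProbabilityMeasure μ] [NormedAddCommGroup F] [NormedSpace ℝ F] {f : α → F}
    (hf : AEStronglyMeasurable f μ) : ‖∫ x, f x ∂μ‖ₑ ^ 2 ≤ ∫⁻ x, ‖f x‖ₑ ^ 2 ∂μ := by
  have h1 : ‖∫ x, f x ∂μ‖ₑ ≤ eLpNorm f 2 μ := by
    refine (enorm_integral_le_lintegral_enorm f).trans ?_
    rw [← eLpNorm_one_eq_lintegral_enorm]
    exact eLpNorm_le_eLpNorm_of_exponent_le (by norm_num) hf
  calc ‖∫ x, f x ∂μ‖ₑ ^ 2 ≤ eLpNorm f 2 μ ^ 2 := by gcongr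
    _ = ∫⁻ x, ‖f x‖ₑ ^ 2 ∂μ := by
      rw [eLpNorm_two_eq, ← ENNReal.rpow_mul_natCast]; norm_num

lemma hasDerivAt_comp_add_smul {d : ℕ} {φ : E d → ℝ} (hφ : ContDiff ℝ (⊤ : ℕ∞) φ) (y h : E d)
    (t : ℝ) : HasDerivAt (fun t : ℝ => φ (y + t • h)) (inner ℝ (gradient φ (y + t • h)) h) t := by
  have h1 := (hφ.differentiable (by simp) (y + t • h)).hasGradientAt.hasFDerivAt
  have h2 : HasDerivAt (fun t : ℝ => y + t • h) h t := by
    simpa using ((hasDerivAt_id t).smul_const h).const_add y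
  exact (h1.comp_hasDerivAt t h2).congr_deriv (by simp)

/-- The fundamental theorem of calculus along the segment from `y` to `y + h`, followed by Jensen
and Cauchy–Schwarz. -/
lemma enorm_sub_sq_le_lintegral {d : ℕ} {φ : E d → ℝ} (hφ : ContDiff ℝ (⊤ : ℕ∞) φ) (y h : E d) :
    ‖φ (y + h) - φ y‖ₑ ^ 2 ≤
      ‖h‖ₑ ^ 2 * ∫⁻ t in Set.Ioc (0 : ℝ) 1, ‖gradient φ (y + t • h)‖ₑ ^ 2 := by
  have hc : Continuous fun t : ℝ => inner ℝ (gradient φ (y + t • h)) h :=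
    ((continuous_gradient hφ).comp (by fun_prop)).inner continuous_const
  have e : φ (y + h) - φ y = ∫ t in Set.Ioc (0 : ℝ) 1, inner ℝ (gradient φ (y + t • h)) h := by
    rw [← intervalIntegral.integral_of_le zero_le_one,
      intervalIntegral.integral_eq_sub_of_hasDerivAt
        (fun t _ => hasDerivAt_comp_add_smul hφ y h t) (hc.intervalIntegrable 0 1)]
    simp
  have : IsProbabilityMeasure (volume.restrict (Set.Ioc (0 : ℝ) 1)) := ⟨by simp⟩
  rw [e, ← lintegral_const_mul' _ _ (by simp)]
  refine (enorm_integral_sq_le hc.aestronglyMeasurable).trans (lintegral_mono fun t => ?_)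
  rw [← mul_pow]
  gcongr
  rw [mul_comm]
  simp only [← ofReal_norm]
  rw [← ENNReal.ofReal_mul (norm_nonneg _)]
  exact ENNReal.ofReal_le_ofReal (norm_inner_le_norm _ _)

/-- After exchanging the integrals in `y` and `t`, periodicity removes the shift `t • h` from the
gradient term. -/
lemma lintegral_enorm_sub_sq_le {d N : ℕ} {φ : E d → ℝ} (hφ : ContDiff ℝ (⊤ : ℕ∞) φ)
    (hp : Periodic N φ) (h : E d) : ∫⁻ y in cube d N, ‖φ (y + h) - φ y‖ₑ ^ 2 ≤
      ‖h‖ₑ ^ 2 * ∫⁻ y in cube d N, ‖gradient φ y‖ₑ ^ 2 := by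
  have hc := continuous_gradient hφ
  have hper : Periodic N fun y => ‖gradient φ y‖ₑ ^ 2 := fun k x => by
    simp only [hp.gradient k x]
  refine (lintegral_mono fun y => enorm_sub_sq_le_lintegral hφ y h).trans ?_
  rw [lintegral_const_mul' _ _ (by simp), lintegral_lintegral_swap]
  · simp [hper.lintegral_add_right]
  · exact (by fun_prop : Continuous fun z : E d × ℝ =>
      ‖gradient φ (z.1 + z.2 • h)‖ₑ ^ 2).measurable.aemeasurable

/-- The uniform probability measure on `Q_N`. -/
noncomputable def cubeProb (d N : ℕ) : Measure (E d) := (volume (cube d N))⁻¹ • cubeMeasure d N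

instance isProbabilityMeasure_cubeProb (d N : ℕ) : IsProbabilityMeasure (cubeProb d N) :=
  ⟨by simp [cubeProb, ENNReal.inv_mul_cancel (volume_cube_ne_zero d N) (volume_cube_ne_top d N)]⟩

lemma integrable_cubeProb_of_continuous {d N : ℕ} {F : Type*} [NormedAddCommGroup F] {f : E d → F}
    (hf : Continuous f) : Integrable f (cubeProb d N) :=
  ((memLp_cube_of_continuous hf 1).integrable le_rfl).smul_measure
    (ENNReal.inv_ne_top.mpr (volume_cube_ne_zero d N))

/-- By periodicity the mean is also the average of `φ (y + h)` over `h` in the cube, so `φ y` minus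
the mean is an average of differences. Jensen and the translation estimate conclude, with `L` a
bound for `‖h‖` on the cube. -/
lemma exists_eLpNorm_sub_mean_le (d N : ℕ) : ∃ L : ℝ≥0, ∀ φ : E d → ℝ, ContDiff ℝ (⊤ : ℕ∞) φ →
    Periodic N φ → eLpNorm (fun y => φ y - ∫ x, φ x ∂(cubeProb d N)) 2 (cubeMeasure d N) ≤
      L * eLpNorm (gradient φ) 2 (cubeMeasure d N) := by
  obtain ⟨L, hL⟩ := (isCompact_cube d N).isBounded.exists_norm_le
  refine ⟨L.toNNReal, fun φ hφ hp => ?_⟩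
  have hL' : ∀ᵐ h ∂(cubeProb d N), ‖h‖ₑ ≤ L.toNNReal := by
    refine Measure.ae_smul_measure ?_ _
    filter_upwards [ae_restrict_mem (measurableSet_cube d N)] with x hx
    rw [← ofReal_norm]
    exact ENNReal.ofReal_le_ofReal (hL x hx)
  have hc := hφ.continuous
  have key : ∀ y, ‖φ y - ∫ x, φ x ∂(cubeProb d N)‖ₑ ^ 2 ≤
      ∫⁻ h, ‖φ (y + h) - φ y‖ₑ ^ 2 ∂(cubeProb d N) := by
    intro y
    have h1 : ∫ x, φ x ∂(cubeProb d N) = ∫ h, φ (y + h) ∂(cubeProb d N) := by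
      rw [cubeProb, integral_smul_measure, integral_smul_measure]
      congr 1
      rw [← hp.integral_add_right y]
      simp only [add_comm]
    have h2 : φ y = ∫ _, φ y ∂(cubeProb d N) := by simp
    have h3 : φ y - ∫ x, φ x ∂(cubeProb d N) = -∫ h, (φ (y + h) - φ y) ∂(cubeProb d N) := by
      rw [integral_sub (integrable_cubeProb_of_continuous (by fun_prop)) (integrable_const _),
        ← h1, ← h2]
      ring
    rw [h3, enorm_neg]
    exact enorm_integral_sq_le (by fun_prop : Continuous fun h => φ (y + h) -
      φ y).aestronglyMeasurable
  have main : ∫⁻ y in cube d N, ‖φ y - ∫ x, φ x ∂(cubeProb d N)‖ₑ ^ 2 ≤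
      (L.toNNReal : ℝ≥0∞) ^ 2 * ∫⁻ y in cube d N, ‖gradient φ y‖ₑ ^ 2 := by
    refine (lintegral_mono key).trans ?_
    rw [lintegral_lintegral_swap (by
      exact (by fun_prop : Continuous fun z : E d × E d =>
        ‖φ (z.1 + z.2) - φ z.1‖ₑ ^ 2).measurable.aemeasurable)]
    refine (lintegral_mono fun h => lintegral_enorm_sub_sq_le hφ hp h).trans ?_
    calc _ ≤ ∫⁻ _, ((L.toNNReal : ℝ≥0∞) ^ 2 * ∫⁻ y in cube d N, ‖gradient φ y‖ₑ ^ 2)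
          ∂(cubeProb d N) := by
          refine lintegral_mono_ae ?_
          filter_upwards [hL'] with h hh
          gcongr
      _ = _ := by simp
  rw [eLpNorm_two_eq, eLpNorm_two_eq]
  calc _ ≤ ((L.toNNReal : ℝ≥0∞) ^ 2 * ∫⁻ y in cube d N, ‖gradient φ y‖ₑ ^ 2) ^ (1 / 2 : ℝ) :=
        ENNReal.rpow_le_rpow main (by norm_num)
    _ = _ := by
      rw [ENNReal.mul_rpow_of_nonneg _ _ (by norm_num), ← ENNReal.rpow_natCast,
        ← ENNReal.rpow_mul]
      norm_num

/-! ### The closed space of gradients -/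

/-- The gradients of the smooth `Q_N`-periodic functions, in `L²(Q_N)^d`. -/
def smoothGradients (d N : ℕ) : Submodule ℝ (Lp (E d) 2 (cubeMeasure d N)) where
  carrier := {u | ∃ φ : E d → ℝ, ContDiff ℝ (⊤ : ℕ∞) φ ∧ Periodic N φ ∧
    u =ᵐ[cubeMeasure d N] gradient φ}
  add_mem' := by
    rintro u v ⟨φ, h1, h2, h3⟩ ⟨φ', h1', h2', h3'⟩
    refine ⟨fun x => φ x + φ' x, h1.add h1', fun k x => by simp only [h2 k x, h2' k x], ?_⟩
    filter_upwards [Lp.coeFn_add u v, h3, h3'] with x e1 e2 e3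
    rw [e1, Pi.add_apply, e2, e3, gradient_add h1 h1']
  zero_mem' := by
    refine ⟨fun _ => 0, contDiff_const, fun _ _ => rfl, ?_⟩
    filter_upwards [Lp.coeFn_zero (E d) 2 (cubeMeasure d N)] with x e1
    rw [e1]; simp [gradient]
  smul_mem' := by
    rintro c u ⟨φ, h1, h2, h3⟩
    refine ⟨fun x => c * φ x, contDiff_const.mul h1, fun k x => by simp only [h2 k x], ?_⟩
    filter_upwards [Lp.coeFn_smul c u, h3] with x e1 e2
    rw [e1, Pi.smul_apply, e2, gradient_const_smul h1]

lemma IsH1Per.toLp_mem {d N : ℕ} {w : E d → ℝ} {g : E d → E d} (h : IsH1Per N w g) :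
    h.memLp_grad.toLp g ∈ (smoothGradients d N).topologicalClosure := by
  obtain ⟨φ, hφ1, hφ2, -, hφ4⟩ := h.exists_approx
  have hm : ∀ n, MemLp (gradient (φ n)) 2 (cubeMeasure d N) := fun n =>
    memLp_cube_of_continuous (continuous_gradient (hφ1 n)) 2
  refine mem_closure_of_tendsto (f := fun n => (hm n).toLp _) (b := atTop) ?_
    (Eventually.of_forall fun n => ⟨φ n, hφ1 n, hφ2 n, (hm n).coeFn_toLp⟩)
  rw [Lp.tendsto_Lp_iff_tendsto_eLpNorm'']
  exact hφ4

/-- An `L²` limit of smooth gradients is a gradient: after subtracting means, Poincaré–Wirtinger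
makes the potentials Cauchy, and their limit is the potential. Periodizing the limits supplies the
extension to `ℝ^d`. -/
lemma exists_isH1Per_of_mem {d N : ℕ} {G : Lp (E d) 2 (cubeMeasure d N)}
    (hG : G ∈ (smoothGradients d N).topologicalClosure) :
    ∃ w, IsH1Per N w (periodize N G) := by
  obtain ⟨v, hv, hlim⟩ := mem_closure_iff_seq_limit.mp hG
  choose φ hφ1 hφ2 hφ3 using hv
  obtain ⟨L, hL⟩ := exists_eLpNorm_sub_mean_le d N
  set m : ℕ → ℝ := fun n => ∫ x, φ n x ∂(cubeProb d N) with hm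
  have hψ1 : ∀ n, ContDiff ℝ (⊤ : ℕ∞) (fun x => φ n x - m n) := fun n =>
    (hφ1 n).sub contDiff_const
  have hψ : ∀ n, MemLp (fun x => φ n x - m n) 2 (cubeMeasure d N) := fun n =>
    memLp_cube_of_continuous (hψ1 n).continuous 2
  have hdist : ∀ n k, dist ((hψ n).toLp _) ((hψ k).toLp _) ≤ L * dist (v n) (v k) := by
    intro n k
    -- Poincaré–Wirtinger is applied to the difference of two approximants.
    have hs : ContDiff ℝ (⊤ : ℕ∞) (fun x => φ n x + (-1) * φ k x) :=
      (hφ1 n).add (contDiff_const.mul (hφ1 k))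
    have := hL _ hs (fun l x => by simp only [hφ2 n l x, hφ2 k l x])
    rw [Lp.dist_def, Lp.dist_def, ← ENNReal.coe_toReal L, ← ENNReal.toReal_mul]
    refine ENNReal.toReal_mono (ENNReal.mul_ne_top ENNReal.coe_ne_top ?_) ?_
    · exact ((Lp.memLp (v n)).sub (Lp.memLp (v k))).2.ne
    · refine le_of_eq_of_le (eLpNorm_congr_ae ?_) (this.trans_eq ?_)
      · filter_upwards [(hψ n).coeFn_toLp, (hψ k).coeFn_toLp] with x e1 e2
        rw [Pi.sub_apply, e1, e2, integral_add
          (integrable_cubeProb_of_continuous (hφ1 n).continuous)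
          ((integrable_cubeProb_of_continuous (hφ1 k).continuous).const_mul _),
          integral_const_mul]
        simp only [hm]
        ring
      · congr 1
        refine eLpNorm_congr_ae ?_
        filter_upwards [hφ3 n, hφ3 k] with x e1 e2
        rw [Pi.sub_apply, e1, e2, gradient_add (hφ1 n) (contDiff_const.mul (hφ1 k)),
          gradient_const_smul (hφ1 k)]
        module
  have hcau : CauchySeq fun n => (hψ n).toLp _ := by
    rw [cauchySeq_iff_tendsto_dist_atTop_0]
    have h0 := (cauchySeq_iff_tendsto_dist_atTop_0.mp hlim.cauchySeq).const_mul (L : ℝ)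
    rw [mul_zero] at h0
    exact squeeze_zero (fun _ => dist_nonneg) (fun z => hdist z.1 z.2) h0
  obtain ⟨W, hW⟩ := cauchySeq_tendsto_of_complete hcau
  refine ⟨periodize N W, (Lp.memLp W).ae_eq (periodize_ae_eq N W).symm,
    (Lp.memLp G).ae_eq (periodize_ae_eq N G).symm, (periodic_periodize N _).aePeriodic,
    (periodic_periodize N _).aePeriodic, fun n x => φ n x - m n, hψ1,
    fun n k x => by simp only [hφ2 n k x], ?_, ?_⟩
  · have := (Lp.tendsto_Lp_iff_tendsto_eLpNorm' _ _).mp hW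
    refine this.congr fun n => eLpNorm_congr_ae ?_
    filter_upwards [(hψ n).coeFn_toLp, periodize_ae_eq N W] with x e1 e2
    rw [Pi.sub_apply, e1, e2]
  · have := (Lp.tendsto_Lp_iff_tendsto_eLpNorm' _ _).mp hlim
    refine this.congr fun n => eLpNorm_congr_ae ?_
    filter_upwards [hφ3 n, periodize_ae_eq N G] with x e1 e2
    rw [Pi.sub_apply, e1, e2, gradient_add_const]

/-! ### Matrix fields -/

lemma norm_act_le {d : ℕ} (a : Matrix (Fin d) (Fin d) ℝ) (v : E d) : ‖act a v‖ ≤ ‖a‖ * ‖v‖ :=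
  Matrix.l2_opNorm_mulVec a v

lemma act_add {d : ℕ} (a : Matrix (Fin d) (Fin d) ℝ) (v w : E d) :
    act a (v + w) = act a v + act a w := by
  ext i; simp [act, Matrix.mulVec_add]

lemma act_smul {d : ℕ} (a : Matrix (Fin d) (Fin d) ℝ) (c : ℝ) (v : E d) :
    act a (c • v) = c • act a v := by
  ext i; simp [act, Matrix.mulVec_smul]

lemma act_sub {d : ℕ} (a : Matrix (Fin d) (Fin d) ℝ) (v w : E d) :
    act a (v - w) = act a v - act a w := by
  ext i; simp [act, Matrix.mulVec_sub]

lemma add_act {d : ℕ} (a b : Matrix (Fin d) (Fin d) ℝ) (v : E d) :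
    act (a + b) v = act a v + act b v := by
  ext i; simp [act, Matrix.add_mulVec]

lemma sub_act {d : ℕ} (a b : Matrix (Fin d) (Fin d) ℝ) (v : E d) :
    act (a - b) v = act a v - act b v := by
  ext i; simp [act, Matrix.sub_mulVec]

lemma smul_act {d : ℕ} (c : ℝ) (a : Matrix (Fin d) (Fin d) ℝ) (v : E d) :
    act (c • a) v = c • act a v := by
  ext i; simp [act, Matrix.smul_mulVec]

lemma continuous_act {d : ℕ} :
    Continuous fun z : Matrix (Fin d) (Fin d) ℝ × E d => act z.1 z.2 := by
  refine (PiLp.continuous_toLp 2 _).comp ?_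
  exact Continuous.matrix_mulVec continuous_fst
    ((PiLp.continuous_ofLp 2 _).comp continuous_snd)

lemma eLpNorm_act_le {α : Type*} [MeasurableSpace α] {μ : Measure α} {d : ℕ}
    {a : α → Matrix (Fin d) (Fin d) ℝ} {K : ℝ} (hK : ∀ᵐ x ∂μ, ‖a x‖ ≤ K) (g : α → E d) :
    eLpNorm (fun x => act (a x) (g x)) 2 μ ≤ ENNReal.ofReal K * eLpNorm g 2 μ := by
  refine eLpNorm_le_mul_eLpNorm_of_ae_le_mul ?_ 2
  filter_upwards [hK] with x hx
  exact (norm_act_le _ _).trans (by gcongr)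

lemma memLp_act {α : Type*} [MeasurableSpace α] {μ : Measure α} {d : ℕ}
    {a : α → Matrix (Fin d) (Fin d) ℝ} {K : ℝ} (ha : AEStronglyMeasurable a μ)
    (hK : ∀ᵐ x ∂μ, ‖a x‖ ≤ K) {g : α → E d} (hg : MemLp g 2 μ) :
    MemLp (fun x => act (a x) (g x)) 2 μ := by
  refine ⟨continuous_act.comp_aestronglyMeasurable (ha.prodMk hg.1),
    (eLpNorm_act_le hK g).trans_lt ?_⟩
  exact ENNReal.mul_lt_top ENNReal.ofReal_lt_top hg.2

/-! ### The `L²` norm and inner product -/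

/-- The `L²` norm, as a real number. -/
noncomputable def l2norm {α : Type*} [MeasurableSpace α] {F : Type*} [NormedAddCommGroup F]
    (μ : Measure α) (f : α → F) : ℝ := (eLpNorm f 2 μ).toReal

section l2norm

variable {α : Type*} [MeasurableSpace α] {μ : Measure α}

lemma l2norm_nonneg {F : Type*} [NormedAddCommGroup F] (f : α → F) : 0 ≤ l2norm μ f :=
  ENNReal.toReal_nonneg

lemma l2norm_add_le {F : Type*} [NormedAddCommGroup F] {f g : α → F} (hf : MemLp f 2 μ)
    (hg : MemLp g 2 μ) : l2norm μ (fun x => f x + g x) ≤ l2norm μ f + l2norm μ g := by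
  rw [l2norm, l2norm, l2norm, ← ENNReal.toReal_add hf.2.ne hg.2.ne]
  exact ENNReal.toReal_mono (ENNReal.add_ne_top.mpr ⟨hf.2.ne, hg.2.ne⟩)
    (eLpNorm_add_le hf.1 hg.1 (by norm_num))

lemma l2norm_act_le {d : ℕ} {a : α → Matrix (Fin d) (Fin d) ℝ} {K : ℝ} (hK0 : 0 ≤ K)
    (hK : ∀ᵐ x ∂μ, ‖a x‖ ≤ K) {g : α → E d} (hg : MemLp g 2 μ) :
    l2norm μ (fun x => act (a x) (g x)) ≤ K * l2norm μ g := by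
  have e : K * l2norm μ g = (ENNReal.ofReal K * eLpNorm g 2 μ).toReal := by
    rw [ENNReal.toReal_mul, ENNReal.toReal_ofReal hK0, l2norm]
  rw [e, l2norm]
  exact ENNReal.toReal_mono (ENNReal.mul_ne_top ENNReal.ofReal_ne_top hg.2.ne)
    (eLpNorm_act_le hK g)

lemma l2norm_const {F : Type*} [NormedAddCommGroup F] [IsFiniteMeasure μ] (v : F) :
    l2norm μ (fun _ => v) = ‖v‖ * √(μ.real Set.univ) := by
  rw [l2norm, eLpNorm_const' v (by norm_num) (by norm_num), ENNReal.toReal_mul, toReal_enorm,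
    ← ENNReal.toReal_rpow, Real.sqrt_eq_rpow, measureReal_def]
  norm_num

lemma integral_inner_eq {d : ℕ} {f g : α → E d} (hf : MemLp f 2 μ) (hg : MemLp g 2 μ) :
    ∫ x, inner ℝ (f x) (g x) ∂μ = inner ℝ (hf.toLp f) (hg.toLp g) := by
  rw [L2.inner_def]
  refine integral_congr_ae ?_
  filter_upwards [hf.coeFn_toLp, hg.coeFn_toLp] with x h1 h2
  rw [h1, h2]

lemma abs_integral_inner_le {d : ℕ} {f g : α → E d} (hf : MemLp f 2 μ) (hg : MemLp g 2 μ) :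
    |∫ x, inner ℝ (f x) (g x) ∂μ| ≤ l2norm μ f * l2norm μ g := by
  rw [integral_inner_eq hf hg, l2norm, l2norm, ← Lp.norm_toLp f hf, ← Lp.norm_toLp g hg]
  exact abs_real_inner_le_norm _ _

lemma integral_norm_sq_eq {d : ℕ} {f : α → E d} (hf : MemLp f 2 μ) :
    ∫ x, ‖f x‖ ^ 2 ∂μ = l2norm μ f ^ 2 := by
  rw [l2norm, ← Lp.norm_toLp f hf, ← real_inner_self_eq_norm_sq, ← integral_inner_eq hf hf]
  simp only [real_inner_self_eq_norm_sq]

lemma integrable_norm_sq {d : ℕ} {f : α → E d} (hf : MemLp f 2 μ) :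
    Integrable (fun x => ‖f x‖ ^ 2) μ := by
  simpa only [real_inner_self_eq_norm_sq] using integrable_inner hf hf

end l2norm

/-! ### Linear elliptic equations on `Q_N` -/

/-- Measurability, boundedness and coercivity of a matrix field on `Q_N`. -/
structure IsElliptic {d : ℕ} (N : ℕ) (γ K : ℝ) (a : E d → Matrix (Fin d) (Fin d) ℝ) : Prop where
  pos : 0 < γ
  nonneg : 0 ≤ K
  aestronglyMeasurable : AEStronglyMeasurable a (cubeMeasure d N)
  norm_le : ∀ᵐ x ∂(cubeMeasure d N), ‖a x‖ ≤ K
  coercive : ∀ᵐ x ∂(cubeMeasure d N), ∀ ξ : E d, γ * ‖ξ‖ ^ 2 ≤ inner ℝ ξ (act (a x) ξ)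

/-- `w ∈ H¹_per(Q_N)`, with gradient `g`, solves
`∫_{Q_N} a ∇w · ∇φ + ∫_{Q_N} F · ∇φ = 0` for all `φ ∈ H¹_per(Q_N)`. -/
def IsWeakSolution {d : ℕ} (N : ℕ) (a : E d → Matrix (Fin d) (Fin d) ℝ) (F : E d → E d)
    (w : E d → ℝ) (g : E d → E d) : Prop :=
  IsH1Per N w g ∧ ∀ φ ψ, IsH1Per N φ ψ →
    (∫ x in cube d N, inner ℝ (act (a x) (g x)) (ψ x)) +
      ∫ x in cube d N, inner ℝ (F x) (ψ x) = 0

section elliptic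

variable {d N : ℕ} {γ K : ℝ} {a : E d → Matrix (Fin d) (Fin d) ℝ}

lemma IsElliptic.memLp_act (ha : IsElliptic N γ K a) {g : E d → E d}
    (hg : MemLp g 2 (cubeMeasure d N)) : MemLp (fun x => act (a x) (g x)) 2 (cubeMeasure d N) :=
  WeakHom.memLp_act ha.aestronglyMeasurable ha.norm_le hg

lemma IsElliptic.mul_l2norm_sq_le (ha : IsElliptic N γ K a) {g : E d → E d}
    (hg : MemLp g 2 (cubeMeasure d N)) :
    γ * l2norm (cubeMeasure d N) g ^ 2 ≤ ∫ x in cube d N, inner ℝ (act (a x) (g x)) (g x) := by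
  rw [← integral_norm_sq_eq hg, ← integral_const_mul]
  refine integral_mono_ae ((integrable_norm_sq hg).const_mul γ)
    (integrable_inner (ha.memLp_act hg) hg) ?_
  filter_upwards [ha.coercive] with x hx
  simpa only [real_inner_comm] using hx (g x)

/-- The energy estimate. -/
lemma IsElliptic.l2norm_le (ha : IsElliptic N γ K a) {F g : E d → E d}
    (hF : MemLp F 2 (cubeMeasure d N)) (hg : MemLp g 2 (cubeMeasure d N))
    (h : (∫ x in cube d N, inner ℝ (act (a x) (g x)) (g x)) +
      ∫ x in cube d N, inner ℝ (F x) (g x) = 0) :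
    l2norm (cubeMeasure d N) g ≤ γ⁻¹ * l2norm (cubeMeasure d N) F := by
  have h1 := ha.mul_l2norm_sq_le hg
  have h2 := abs_le.mp (abs_integral_inner_le hF hg)
  have h3 : γ * l2norm (cubeMeasure d N) g ^ 2 ≤
      l2norm (cubeMeasure d N) F * l2norm (cubeMeasure d N) g := by linarith [h2.1]
  rw [← div_eq_inv_mul, le_div_iff₀' ha.pos]
  rcases (l2norm_nonneg (μ := cubeMeasure d N) g).eq_or_lt with h0 | h0
  · rw [← h0, mul_zero]; exact l2norm_nonneg F
  · exact le_of_mul_le_mul_right (by linarith) h0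

lemma IsWeakSolution.l2norm_le (ha : IsElliptic N γ K a) {F : E d → E d}
    (hF : MemLp F 2 (cubeMeasure d N)) {w : E d → ℝ} {g : E d → E d}
    (h : IsWeakSolution N a F w g) :
    l2norm (cubeMeasure d N) g ≤ γ⁻¹ * l2norm (cubeMeasure d N) F :=
  ha.l2norm_le hF h.1.memLp_grad (h.2 w g h.1)

/-- The difference of two solutions, tested against itself, satisfies the energy estimate with zero
source. -/
lemma IsWeakSolution.ae_eq (ha : IsElliptic N γ K a) {F : E d → E d} {w w' : E d → ℝ}
    {g g' : E d → E d} (h : IsWeakSolution N a F w g) (h' : IsWeakSolution N a F w' g') :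
    g' =ᵐ[volume] g := by
  have hs := h'.1.sub h.1
  have hz : l2norm (cubeMeasure d N) (fun x => g' x - g x) ≤
      γ⁻¹ * l2norm (cubeMeasure d N) (fun _ => (0 : E d)) := by
    refine ha.l2norm_le (MemLp.zero' (ε := E d)) hs.memLp_grad ?_
    have e1 := h.2 _ _ hs
    have e2 := h'.2 _ _ hs
    simp only [act_sub, inner_sub_left _ _ (g' _ - g _), inner_zero_left, integral_zero, add_zero]
    rw [integral_sub (integrable_inner (ha.memLp_act h'.1.memLp_grad) hs.memLp_grad)
      (integrable_inner (ha.memLp_act h.1.memLp_grad) hs.memLp_grad)]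
    linarith
  have h0 : eLpNorm (fun x => g' x - g x) 2 (cubeMeasure d N) = 0 := by
    have : l2norm (cubeMeasure d N) (fun x => g' x - g x) = 0 :=
      le_antisymm (by simpa [l2norm] using hz) (l2norm_nonneg _)
    exact ((ENNReal.toReal_eq_zero_iff _).mp this).resolve_right hs.memLp_grad.2.ne
  refine h'.1.periodic_grad.ae_eq_of_ae_eq_cube h.1.periodic_grad ?_
  filter_upwards [(eLpNorm_eq_zero_iff hs.memLp_grad.1 (by norm_num)).mp h0] with x hx
  exact sub_eq_zero.mp hx

/-- The bounded operator on `L²` given by the action of an elliptic matrix field. -/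
noncomputable def IsElliptic.toCLM (ha : IsElliptic N γ K a) :
    Lp (E d) 2 (cubeMeasure d N) →L[ℝ] Lp (E d) 2 (cubeMeasure d N) :=
  LinearMap.mkContinuous
    { toFun := fun u => (ha.memLp_act (Lp.memLp u)).toLp _
      map_add' := fun u v => by
        rw [← MemLp.toLp_add, MemLp.toLp_eq_toLp_iff]
        filter_upwards [Lp.coeFn_add u v] with x hx
        rw [hx, Pi.add_apply, act_add, Pi.add_apply]
      map_smul' := fun c u => by
        rw [RingHom.id_apply, ← MemLp.toLp_const_smul, MemLp.toLp_eq_toLp_iff]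
        filter_upwards [Lp.coeFn_smul c u] with x hx
        rw [hx, Pi.smul_apply, act_smul, Pi.smul_apply] } K fun u => by
    exact (Lp.norm_toLp _ (ha.memLp_act (Lp.memLp u))).trans_le
      (l2norm_act_le ha.nonneg ha.norm_le (Lp.memLp u))

lemma IsElliptic.toCLM_apply (ha : IsElliptic N γ K a) (u : Lp (E d) 2 (cubeMeasure d N)) :
    ha.toCLM u = (ha.memLp_act (Lp.memLp u)).toLp _ := rfl

/-- Lax–Milgram with the gradient itself as unknown, in the closed space of gradients. The form is
then coercive for the `L²` norm with constant `γ`, and the potential is recovered afterwards. -/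
lemma IsElliptic.exists_isWeakSolution (ha : IsElliptic N γ K a) {F : E d → E d}
    (hF : MemLp F 2 (cubeMeasure d N)) : ∃ w g, IsWeakSolution N a F w g := by
  set V := (smoothGradients d N).topologicalClosure with hV
  have : CompleteSpace V := (smoothGradients d N).isClosed_topologicalClosure.completeSpace_coe
  let B : V →L[ℝ] V →L[ℝ] ℝ :=
    (innerSL ℝ).bilinearComp (ha.toCLM ∘L V.subtypeL) V.subtypeL
  have hB : ∀ u v : V, B u v = inner ℝ (ha.toCLM u) (v : Lp (E d) 2 (cubeMeasure d N)) :=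
    fun u v => rfl
  have hco : IsCoercive B := by
    refine ⟨γ, ha.pos, fun u => ?_⟩
    have := ha.mul_l2norm_sq_le (Lp.memLp u.1)
    rw [integral_inner_eq (ha.memLp_act (Lp.memLp u.1)) (Lp.memLp u.1), Lp.toLp_coeFn] at this
    rw [hB, ha.toCLM_apply, mul_assoc, ← sq]
    exact this
  let f : V := (InnerProductSpace.toDual ℝ V).symm
    (-(innerSL ℝ (hF.toLp F)).comp V.subtypeL)
  let u : V := hco.continuousLinearEquivOfBilin.symm f
  have hu : ∀ v : V, inner ℝ (ha.toCLM u) (v : Lp (E d) 2 (cubeMeasure d N)) +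
      inner ℝ (hF.toLp F) (v : Lp (E d) 2 (cubeMeasure d N)) = 0 := by
    intro v
    have h1 := hco.continuousLinearEquivOfBilin_apply u v
    rw [ContinuousLinearEquiv.apply_symm_apply, InnerProductSpace.toDual_symm_apply, hB] at h1
    rw [← h1]
    simp
  obtain ⟨w, hw⟩ := exists_isH1Per_of_mem u.2
  refine ⟨w, _, hw, fun φ ψ hφ => ?_⟩
  have := hu ⟨_, hφ.toLp_mem⟩
  rw [← this, integral_inner_eq hF hφ.memLp_grad,
    integral_inner_eq (ha.memLp_act hw.memLp_grad) hφ.memLp_grad, ha.toCLM_apply]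
  -- The gradient of `w` is the periodized `u`, which agrees with `u` almost everywhere on `Q_N`.
  congr 2
  rw [MemLp.toLp_eq_toLp_iff]
  filter_upwards [periodize_ae_eq N u.1] with x hx
  rw [hx]

end elliptic

/-! ### Correctors for a fixed realization -/

section corrector

variable {d N : ℕ} {γ K : ℝ} {a : E d → Matrix (Fin d) (Fin d) ℝ} {p : E d}

lemma memLp_add_const {g : E d → E d} (hg : MemLp g 2 (cubeMeasure d N)) (p : E d) :
    MemLp (fun x => p + g x) 2 (cubeMeasure d N) := (memLp_const p).add hg

lemma IsElliptic.isCorrector_iff (ha : IsElliptic N γ K a) {w : E d → ℝ} {g : E d → E d} :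
    IsCorrector N a p w g ↔ IsWeakSolution N a (fun x => act (a x) p) w g := by
  refine and_congr_right fun h => forall₂_congr fun φ ψ => forall_congr' fun hφ => ?_
  rw [← integral_add (integrable_inner (ha.memLp_act h.memLp_grad) hφ.memLp_grad)
    (integrable_inner (ha.memLp_act (memLp_const p)) hφ.memLp_grad)]
  simp only [← inner_add_left, ← act_add, add_comm]

lemma IsElliptic.exists_isCorrector (ha : IsElliptic N γ K a) (p : E d) :
    ∃ w g, IsCorrector N a p w g ∧
      ∀ w' g', IsCorrector N a p w' g' → g' =ᵐ[volume] g := by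
  obtain ⟨w, g, h⟩ := ha.exists_isWeakSolution (ha.memLp_act (memLp_const p))
  exact ⟨w, g, ha.isCorrector_iff.mpr h, fun w' g' h' =>
    h.ae_eq ha (ha.isCorrector_iff.mp h')⟩

lemma IsElliptic.exists_isFirstOrderCorrector (ha : IsElliptic N γ K a) {K₁ : ℝ}
    {c : E d → Matrix (Fin d) (Fin d) ℝ} (hc : AEStronglyMeasurable c (cubeMeasure d N))
    (hK : ∀ᵐ x ∂(cubeMeasure d N), ‖c x‖ ≤ K₁) {g₀ : E d → E d}
    (hg₀ : MemLp g₀ 2 (cubeMeasure d N)) (p : E d) :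
    ∃ w g, IsFirstOrderCorrector N a c p g₀ w g ∧
      ∀ w' g', IsFirstOrderCorrector N a c p g₀ w' g' → g' =ᵐ[volume] g := by
  obtain ⟨w, g, h⟩ := ha.exists_isWeakSolution (WeakHom.memLp_act hc hK (memLp_add_const hg₀ p))
  exact ⟨w, g, h, fun w' g' h' => IsWeakSolution.ae_eq ha h h'⟩

lemma AEPeriodic.act {b : E d → Matrix (Fin d) (Fin d) ℝ} {g : E d → E d}
    (hb : AEPeriodic N b) (hg : AEPeriodic N g) (p : E d) :
    AEPeriodic N fun x => act (b x) (p + g x) := by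
  intro k
  filter_upwards [hb k, hg k] with x h1 h2
  rw [h1, h2]

/-- The periodic corrector on `Q` is also the corrector on `Q_N`. -/
lemma IsCorrector.of_unit {b : E d → Matrix (Fin d) (Fin d) ℝ} (hb : AEPeriodic 0 b)
    (hbe : IsElliptic 0 γ K b) {w : E d → ℝ} {g : E d → E d} (h : IsCorrector 0 b p w g) (N : ℕ) :
    IsCorrector N b p w g :=
  ⟨h.1.of_unit N, fun _ _ hφ => integral_inner_cube_eq_zero_of_unit (hb.act h.1.periodic_grad p)
    (hbe.memLp_act (memLp_add_const h.1.memLp_grad p)) h.2 hφ⟩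

end corrector

/-! ### The second order estimate for a fixed realization -/

/-- The matrix field `a` is elliptic and equals `b + η c` up to an error of order `η²` on `Q_N`,
where `b` is periodic. -/
structure IsPerturbation {d : ℕ} (N : ℕ) (γ K R η : ℝ)
    (a b c : E d → Matrix (Fin d) (Fin d) ℝ) : Prop where
  elliptic : IsElliptic N γ K a
  periodic : AEPeriodic 0 b
  elliptic_unit : IsElliptic 0 γ K b
  elliptic_per : IsElliptic N γ K b
  aestronglyMeasurable : AEStronglyMeasurable c (cubeMeasure d N)
  norm_le : ∀ᵐ x ∂(cubeMeasure d N), ‖c x‖ ≤ K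
  remainder_nonneg : 0 ≤ R
  abs_le_one : |η| ≤ 1
  remainder_le : ∀ᵐ x ∂(cubeMeasure d N), ‖a x - b x - η • c x‖ ≤ R * η ^ 2

/-- The constant in the estimate of the right-hand side of the equation for the second order
error. -/
noncomputable def sourceConst (γ K R : ℝ) : ℝ :=
  (R + (K + R) * (γ⁻¹ * K)) * (1 + γ⁻¹ * K)

/-- The right-hand side of the equation for the second order error. -/
def errorSource {d : ℕ} (η : ℝ) (a b c : E d → Matrix (Fin d) (Fin d) ℝ) (p : E d)
    (g₀ g₁ : E d → E d) (x : E d) : E d :=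
  act (a x - b x - η • c x) (p + g₀ x) + act (η • (a x - b x)) (g₁ x)

/-- The identity behind both estimates. Against a gradient, each flux on the right integrates to
zero by a corrector equation; averaged over `Q_N`, the right side is the error of the homogenized
matrices. -/
lemma act_error_add_errorSource {d : ℕ} (η : ℝ) (a b c : E d → Matrix (Fin d) (Fin d) ℝ)
    (p : E d) (g g₀ g₁ : E d → E d) (x : E d) :
    act (a x) (g x - g₀ x - η • g₁ x) + errorSource η a b c p g₀ g₁ x =
      act (a x) (p + g x) - act (b x) (p + g₀ x) -
        η • (act (b x) (g₁ x) + act (c x) (p + g₀ x)) := by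
  simp only [errorSource, act_sub, act_add, sub_act, smul_act, act_smul]
  module

lemma integral_sub_sub_mul_add {α : Type*} [MeasurableSpace α] {μ : Measure α}
    {f₁ f₂ f₃ f₄ : α → ℝ} (h₁ : Integrable f₁ μ) (h₂ : Integrable f₂ μ) (h₃ : Integrable f₃ μ)
    (h₄ : Integrable f₄ μ) (η : ℝ) :
    ∫ x, (f₁ x - f₂ x - η * (f₃ x + f₄ x)) ∂μ =
      ∫ x, f₁ x ∂μ - ∫ x, f₂ x ∂μ - η * (∫ x, f₃ x ∂μ + ∫ x, f₄ x ∂μ) := by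
  have h12 : Integrable (fun x => f₁ x - f₂ x) μ := h₁.sub h₂
  have h34 : Integrable (fun x => f₃ x + f₄ x) μ := h₃.add h₄
  rw [integral_sub h12 (h34.const_mul η), integral_sub h₁ h₂, integral_const_mul,
    integral_add h₃ h₄]

section estimate

variable {d N : ℕ} {γ K R η : ℝ} {a b c : E d → Matrix (Fin d) (Fin d) ℝ} {p : E d}
  {w w₀ w₁ : E d → ℝ} {g g₀ g₁ : E d → E d}

/-- Since `a - b` is `η c` plus the remainder, one more factor `η` gives `K η² + R |η|³`, and `|η| ≤
1` absorbs the cube. -/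
lemma IsPerturbation.norm_sub_le (h : IsPerturbation N γ K R η a b c) :
    ∀ᵐ x ∂(cubeMeasure d N), ‖η • (a x - b x)‖ ≤ (K + R) * η ^ 2 := by
  filter_upwards [h.norm_le, h.remainder_le] with x h1 h2
  have e : a x - b x = (a x - b x - η • c x) + η • c x := by abel
  have h3 : ‖a x - b x‖ ≤ R * η ^ 2 + |η| * K := by
    rw [e]
    refine (norm_add_le _ _).trans (add_le_add h2 ?_)
    rw [norm_smul, Real.norm_eq_abs]
    gcongr
  rw [norm_smul, Real.norm_eq_abs]
  have h4 : |η| ^ 2 = η ^ 2 := sq_abs η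
  have h5 := abs_nonneg η
  have h6 : |η| * ‖a x - b x‖ ≤ |η| * (R * η ^ 2 + |η| * K) := by gcongr
  have h7 : |η| * (R * η ^ 2) ≤ 1 * (R * η ^ 2) :=
    mul_le_mul_of_nonneg_right h.abs_le_one (mul_nonneg h.remainder_nonneg (sq_nonneg η))
  have h8 : |η| * (|η| * K) = K * η ^ 2 := by rw [← h4]; ring
  linarith

lemma IsPerturbation.memLp_errorSource (h : IsPerturbation N γ K R η a b c)
    (hg₀ : MemLp g₀ 2 (cubeMeasure d N)) (hg₁ : MemLp g₁ 2 (cubeMeasure d N)) :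
    MemLp (errorSource η a b c p g₀ g₁) 2 (cubeMeasure d N) := by
  have h1 := h.elliptic.aestronglyMeasurable.sub h.elliptic_per.aestronglyMeasurable
  exact (memLp_act (h1.sub (h.aestronglyMeasurable.const_smul η)) h.remainder_le
    (memLp_add_const hg₀ p)).add (memLp_act (h1.const_smul η) h.norm_sub_le hg₁)

/-- In `sourceConst`, `1 + γ⁻¹ K` bounds `p + ∇w⁰` relative to the constant field `p`, `γ⁻¹ K`
bounds `∇w¹` relative to `p + ∇w⁰`, and `R` and `K + R` bound the two matrix coefficients of the
source. -/
lemma IsPerturbation.l2norm_errorSource_le (h : IsPerturbation N γ K R η a b c)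
    (h₀ : IsCorrector 0 b p w₀ g₀) (h₁ : IsFirstOrderCorrector N b c p g₀ w₁ g₁) :
    l2norm (cubeMeasure d N) (errorSource η a b c p g₀ g₁) ≤
      sourceConst γ K R * η ^ 2 * (‖p‖ * √(volume.real (cube d N))) := by
  set s := √(volume.real (cube d N)) with hs
  have hpos := h.elliptic.pos
  have hK := h.elliptic.nonneg
  have hR := h.remainder_nonneg
  have h₀' := h₀.of_unit h.periodic h.elliptic_unit N
  have hg₀ := h₀'.1.memLp_grad
  have hg₁ := h₁.1.memLp_grad
  have hc : l2norm (cubeMeasure d N) (fun _ => p) = ‖p‖ * s := by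
    rw [l2norm_const]; simp [hs]
  have e0 : l2norm (cubeMeasure d N) g₀ ≤ γ⁻¹ * (K * (‖p‖ * s)) := by
    refine (IsWeakSolution.l2norm_le h.elliptic_per (h.elliptic_per.memLp_act (memLp_const p))
      (h.elliptic_per.isCorrector_iff.mp h₀')).trans ?_
    rw [← hc]
    gcongr
    exact l2norm_act_le hK h.elliptic_per.norm_le (memLp_const p)
  have e1 : l2norm (cubeMeasure d N) (fun x => p + g₀ x) ≤ (1 + γ⁻¹ * K) * (‖p‖ * s) := by
    refine (l2norm_add_le (memLp_const p) hg₀).trans ?_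
    rw [hc]
    linarith
  have e2 : l2norm (cubeMeasure d N) g₁ ≤
      γ⁻¹ * (K * l2norm (cubeMeasure d N) (fun x => p + g₀ x)) := by
    refine (IsWeakSolution.l2norm_le h.elliptic_per
      (memLp_act h.aestronglyMeasurable h.norm_le (memLp_add_const hg₀ p)) h₁).trans ?_
    gcongr
    exact l2norm_act_le hK h.norm_le (memLp_add_const hg₀ p)
  have hab := h.elliptic.aestronglyMeasurable.sub h.elliptic_per.aestronglyMeasurable
  have e3 : l2norm (cubeMeasure d N) (errorSource η a b c p g₀ g₁) ≤
      R * η ^ 2 * l2norm (cubeMeasure d N) (fun x => p + g₀ x) +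
        (K + R) * η ^ 2 * l2norm (cubeMeasure d N) g₁ := by
    refine (l2norm_add_le
      (memLp_act (hab.sub (h.aestronglyMeasurable.const_smul η)) h.remainder_le
        (memLp_add_const hg₀ p))
      (memLp_act (hab.const_smul η) h.norm_sub_le hg₁)).trans (add_le_add ?_ ?_)
    · exact l2norm_act_le (by positivity) h.remainder_le (memLp_add_const hg₀ p)
    · exact l2norm_act_le (by positivity) h.norm_sub_le hg₁
  calc _ ≤ R * η ^ 2 * l2norm (cubeMeasure d N) (fun x => p + g₀ x) + (K + R) * η ^ 2 *
        (γ⁻¹ * (K * l2norm (cubeMeasure d N) (fun x => p + g₀ x))) := by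
        refine e3.trans ?_; gcongr
    _ = (R + (K + R) * (γ⁻¹ * K)) * η ^ 2 *
        l2norm (cubeMeasure d N) (fun x => p + g₀ x) := by ring
    _ ≤ (R + (K + R) * (γ⁻¹ * K)) * η ^ 2 * ((1 + γ⁻¹ * K) * (‖p‖ * s)) := by gcongr
    _ = _ := by rw [sourceConst]; ring

/-- The equation satisfied by the second order error. -/
lemma IsPerturbation.isWeakSolution_error (h : IsPerturbation N γ K R η a b c)
    (h₀ : IsCorrector 0 b p w₀ g₀) (hg : IsCorrector N a p w g)
    (h₁ : IsFirstOrderCorrector N b c p g₀ w₁ g₁) :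
    IsWeakSolution N a (errorSource η a b c p g₀ g₁) (fun x => w x - w₀ x - η * w₁ x)
      (fun x => g x - g₀ x - η • g₁ x) := by
  have h₀' := h₀.of_unit h.periodic h.elliptic_unit N
  have hz : IsH1Per N (fun x => w x - w₀ x - η * w₁ x) (fun x => g x - g₀ x - η • g₁ x) := by
    simpa [sub_eq_add_neg] using (hg.1.sub h₀'.1).add_smul h₁.1 (-η)
  refine ⟨hz, fun φ ψ hφ => ?_⟩
  have hψ := hφ.memLp_grad
  have hg₀ := h₀'.1.memLp_grad
  have hg₁ := h₁.1.memLp_grad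
  rw [← integral_add (integrable_inner (h.elliptic.memLp_act hz.memLp_grad) hψ)
    (integrable_inner (h.memLp_errorSource hg₀ hg₁) hψ)]
  simp only [← inner_add_left, act_error_add_errorSource, inner_sub_left _ _ (ψ _),
    real_inner_smul_left]
  have i1 := integrable_inner (h.elliptic.memLp_act (memLp_add_const hg.1.memLp_grad p)) hψ
  have i2 := integrable_inner (h.elliptic_per.memLp_act (memLp_add_const hg₀ p)) hψ
  have i3 := integrable_inner (h.elliptic_per.memLp_act hg₁) hψ
  have i4 := integrable_inner
    (memLp_act h.aestronglyMeasurable h.norm_le (memLp_add_const hg₀ p)) hψ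
  have e := h₁.2 φ ψ hφ
  simp only [inner_add_left _ _ (ψ _)]
  -- The three corrector equations, all on `Q_N`, annihilate the three groups of terms.
  rw [integral_sub_sub_mul_add i1 i2 i3 i4, hg.2 φ ψ hφ, h₀'.2 φ ψ hφ, e]
  simp

lemma IsPerturbation.l2norm_error_le (h : IsPerturbation N γ K R η a b c)
    (h₀ : IsCorrector 0 b p w₀ g₀) (hg : IsCorrector N a p w g)
    (h₁ : IsFirstOrderCorrector N b c p g₀ w₁ g₁) :
    l2norm (cubeMeasure d N) (fun x => g x - g₀ x - η • g₁ x) ≤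
      γ⁻¹ * (sourceConst γ K R * η ^ 2 * (‖p‖ * √(volume.real (cube d N)))) := by
  have := h.elliptic.pos
  refine (IsWeakSolution.l2norm_le h.elliptic (h.memLp_errorSource
    (h₀.of_unit h.periodic h.elliptic_unit N).1.memLp_grad h₁.1.memLp_grad)
    (h.isWeakSolution_error h₀ hg h₁)).trans ?_
  gcongr
  exact h.l2norm_errorSource_le h₀ h₁

lemma abs_integral_apply_le {F : E d → E d} (hF : MemLp F 2 (cubeMeasure d N)) (i : Fin d) :
    |∫ x in cube d N, F x i| ≤ l2norm (cubeMeasure d N) F * √(volume.real (cube d N)) := by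
  have := abs_integral_inner_le hF
    (memLp_const (μ := cubeMeasure d N) (EuclideanSpace.single i (1 : ℝ)))
  rw [l2norm_const] at this
  simpa [EuclideanSpace.inner_single_right] using this

lemma integrable_apply {F : E d → E d} (hF : MemLp F 2 (cubeMeasure d N)) (i : Fin d) :
    Integrable (fun x => F x i) (cubeMeasure d N) := by
  have := integrable_inner hF
    (memLp_const (μ := cubeMeasure d N) (EuclideanSpace.single i (1 : ℝ)))
  simpa [EuclideanSpace.inner_single_right] using this

end estimate

/-- The constant in the second order estimate of the homogenized matrices. -/
noncomputable def entryConst (γ K R : ℝ) : ℝ := (K * γ⁻¹ + 1) * sourceConst γ K R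

lemma IsPerturbation.abs_entry_le {d N : ℕ} {γ K R η : ℝ}
    {a b c : E d → Matrix (Fin d) (Fin d) ℝ} (h : IsPerturbation N γ K R η a b c)
    {w w₀ w₁ : Fin d → E d → ℝ} {g g₀ g₁ : Fin d → E d → E d}
    (h₀ : ∀ j, IsCorrector 0 b (EuclideanSpace.single j 1) (w₀ j) (g₀ j))
    (hg : ∀ j, IsCorrector N a (EuclideanSpace.single j 1) (w j) (g j))
    (h₁ : ∀ j, IsFirstOrderCorrector N b c (EuclideanSpace.single j 1) (g₀ j) (w₁ j) (g₁ j))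
    (i j : Fin d) :
    |(homMatrix N a g - homMatrix 0 b g₀ - η • firstOrderMatrix N b c g₀ g₁) i j| ≤
      entryConst γ K R * η ^ 2 := by
  set p : E d := EuclideanSpace.single j 1 with hp
  have hp1 : ‖p‖ = 1 := by simp [hp]
  have h₀' := (h₀ j).of_unit h.periodic h.elliptic_unit N
  have hg₀ := h₀'.1.memLp_grad
  have hg₁ := (h₁ j).1.memLp_grad
  have i1 := integrable_apply (h.elliptic.memLp_act (memLp_add_const (hg j).1.memLp_grad p)) i
  have i2 := integrable_apply (h.elliptic_per.memLp_act (memLp_add_const hg₀ p)) i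
  have i3 := integrable_apply (h.elliptic_per.memLp_act hg₁) i
  have i4 := integrable_apply
    (memLp_act h.aestronglyMeasurable h.norm_le (memLp_add_const hg₀ p)) i
  have hz := h.isWeakSolution_error (h₀ j) (hg j) (h₁ j)
  have hm1 := h.elliptic.memLp_act hz.1.memLp_grad
  have hm2 := h.memLp_errorSource (p := p) hg₀ hg₁
  -- The periodic flux has the same mean over `Q` and over `Q_N`, so all the entries become averages
  -- over `Q_N`.
  have hper : (volume.real (cube d 0))⁻¹ * ∫ x in cube d 0, act (b x) (p + g₀ j x) i =
      (volume.real (cube d N))⁻¹ * ∫ x in cube d N, act (b x) (p + g₀ j x) i := by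
    refine (AEPeriodic.integral_cube N (fun k => ?_) i2).symm
    filter_upwards [h.periodic.act (h₀ j).1.periodic_grad p k] with x hx
    rw [hx]
  have key : (homMatrix N a g - homMatrix 0 b g₀ - η • firstOrderMatrix N b c g₀ g₁) i j =
      (volume.real (cube d N))⁻¹ * ∫ x in cube d N,
        (act (a x) (g j x - g₀ j x - η • g₁ j x) +
          errorSource η a b c p (g₀ j) (g₁ j) x) i := by
    simp only [act_error_add_errorSource]
    simp only [PiLp.sub_apply, PiLp.smul_apply, PiLp.add_apply, smul_eq_mul]
    rw [integral_sub_sub_mul_add i1 i2 i3 i4]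
    simp only [Matrix.sub_apply, Matrix.smul_apply, homMatrix, firstOrderMatrix, Matrix.of_apply,
      smul_eq_mul, ← hp, hper, add_comm (g₀ j _) p]
    ring
  have hv : 0 < volume.real (cube d N) := by rw [volume_real_cube]; positivity
  set s := √(volume.real (cube d N)) with hs
  have hs2 : s * s = volume.real (cube d N) := Real.mul_self_sqrt hv.le
  have e1 := h.l2norm_error_le (h₀ j) (hg j) (h₁ j)
  have e2 := h.l2norm_errorSource_le (h₀ j) (h₁ j)
  rw [← hp, ← hs, hp1, one_mul] at e1 e2
  have hK := h.elliptic.nonneg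
  -- In `entryConst`, `K γ⁻¹` comes from `a` acting on the error and `1` from the source. The two
  -- factors `√|Q_N|`, from the `L²` bounds and from Cauchy–Schwarz, cancel the normalization.
  have e3 := (abs_integral_apply_le (hm1.add hm2) i).trans (mul_le_mul_of_nonneg_right
    ((l2norm_add_le hm1 hm2).trans (add_le_add ((l2norm_act_le hK h.elliptic.norm_le
      hz.1.memLp_grad).trans (mul_le_mul_of_nonneg_left e1 hK)) e2)) (Real.sqrt_nonneg _))
  rw [key, abs_mul, abs_inv, abs_of_pos hv, inv_mul_le_iff₀ hv]
  refine e3.trans_eq ?_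
  rw [← hs, ← hs2, entryConst]
  ring

lemma l2_opNorm_le_of_abs_entry_le {d : ℕ} {m : Matrix (Fin d) (Fin d) ℝ} {B : ℝ}
    (h : ∀ i j, |m i j| ≤ B) :
    ‖m‖ ≤ B * ∑ i : Fin d, ∑ j : Fin d, ‖Matrix.single i j (1 : ℝ)‖ := by
  conv_lhs => rw [Matrix.matrix_eq_sum_single m]
  rw [Finset.mul_sum]
  refine (norm_sum_le _ _).trans (Finset.sum_le_sum fun i _ => ?_)
  rw [Finset.mul_sum]
  refine (norm_sum_le _ _).trans (Finset.sum_le_sum fun j _ => ?_)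
  have : Matrix.single i j (m i j) = m i j • Matrix.single i j (1 : ℝ) := by simp
  rw [this, norm_smul, Real.norm_eq_abs]
  gcongr
  exact h i j

/-! ### Stationary fields -/

section stationary

variable {d : ℕ} {Ω : Type*} [MeasurableSpace Ω] {P : Measure Ω} [SFinite P]

lemma ae_ae_of_ae_prod_right {α : Type*} [MeasurableSpace α] {μ : Measure α} [SFinite μ]
    {S : α → Ω → Prop} (h : ∀ᵐ z ∂(μ.prod P), S z.1 z.2) : ∀ᵐ ω ∂P, ∀ᵐ x ∂μ, S x ω := by
  have := (Measure.measurePreserving_swap (μ := P) (ν := μ)).quasiMeasurePreserving.ae h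
  exact Measure.ae_ae_of_ae_prod this

lemma ae_aestronglyMeasurable_section {α β : Type*} [MeasurableSpace α] {μ : Measure α}
    [SFinite μ] [TopologicalSpace β] {F : α → Ω → β}
    (h : AEStronglyMeasurable (fun z : α × Ω => F z.1 z.2) (μ.prod P)) :
    ∀ᵐ ω ∂P, AEStronglyMeasurable (fun x => F x ω) μ :=
  h.prod_swap.prodMk_left

lemma ae_cube_prod_of_ae {S : E d × Ω → Prop} (h : ∀ᵐ z ∂(volume.prod P), S z) :
    ∀ᵐ z ∂((cubeMeasure d 0).prod P), S z :=
  (Measure.restrict_le_self.absolutelyContinuous.prod Measure.AbsolutelyContinuous.rfl).ae_le h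

variable [AddAction (Fin d → ℤ) Ω] [MeasurableConstVAdd (Fin d → ℤ) Ω]
  [VAddInvariantMeasure (Fin d → ℤ) Ω P]

lemma measurePreserving_prod_vadd (k : Fin d → ℤ) :
    MeasurePreserving (fun z : E d × Ω => (z.1, k +ᵥ z.2)) ((cubeMeasure d 0).prod P)
      ((cubeMeasure d 0).prod P) :=
  (MeasurePreserving.id (cubeMeasure d 0)).prod (measurePreserving_vadd k P)

/-- A stationary property that holds almost surely on `Q` holds almost surely on `ℝ^d`. -/
lemma Stationary.ae_ae {S : E d → Ω → Prop} (hst : Stationary P S)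
    (h : ∀ᵐ z ∂((cubeMeasure d 0).prod P), S z.1 z.2) :
    ∀ᵐ ω ∂P, ∀ᵐ x : E d, S x ω := by
  have hk : ∀ᵐ ω ∂P, ∀ k : Fin d → ℤ, ∀ᵐ x ∂(cubeMeasure d 0), S (x + intVec k) ω := by
    rw [ae_all_iff]
    intro k
    refine ae_ae_of_ae_prod_right (S := fun x ω => S (x + intVec k) ω) ?_
    filter_upwards [(measurePreserving_prod_vadd k).quasiMeasurePreserving.ae h,
      ae_cube_prod_of_ae (hst k)] with z h1 h2
    rw [h2]
    exact h1
  filter_upwards [hk] with ω hω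
  exact ae_of_forall_ae_cube_add 0 fun k => by simpa using hω k

lemma Stationary.ae_norm_le {F : Type*} [NormedAddCommGroup F] {f : E d → Ω → F}
    (hst : Stationary P f) {B : ℝ}
    (h : ∀ᵐ z ∂((cubeMeasure d 0).prod P), ‖f z.1 z.2‖ ≤ B) :
    ∀ᵐ ω ∂P, ∀ᵐ x : E d, ‖f x ω‖ ≤ B := by
  refine Stationary.ae_ae (S := fun x ω => ‖f x ω‖ ≤ B) (fun k => ?_) h
  filter_upwards [hst k] with z hz
  rw [hz]

/-- Joint measurability is known only on `Q × Ω`. On the cell shifted by `k` the field is the one on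
`Q` composed with `τ_k`, which preserves the measure. -/
lemma Stationary.ae_aestronglyMeasurable {F : Type*} [TopologicalSpace F]
    [TopologicalSpace.PseudoMetrizableSpace F] {f : E d → Ω → F}
    (hst : Stationary P f)
    (h : AEStronglyMeasurable (fun z : E d × Ω => f z.1 z.2) ((cubeMeasure d 0).prod P)) :
    ∀ᵐ ω ∂P, ∀ N, AEStronglyMeasurable (fun x => f x ω) (cubeMeasure d N) := by
  have hk : ∀ᵐ ω ∂P, ∀ k : Fin d → ℤ,
      AEStronglyMeasurable (fun x => f (x + intVec k) ω) (cubeMeasure d 0) := by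
    rw [ae_all_iff]
    intro k
    refine ae_aestronglyMeasurable_section (F := fun x ω => f (x + intVec k) ω) ?_
    refine (h.comp_measurePreserving (measurePreserving_prod_vadd k)).congr ?_
    filter_upwards [ae_cube_prod_of_ae (hst k)] with z hz
    exact hz.symm
  filter_upwards [hk] with ω hω N
  rw [cubeMeasure_eq_sum_map, ← Measure.sum_fintype, aestronglyMeasurable_sum_measure_iff]
  intro c
  rw [(measurableEmbedding_addRight (intVec (cellShift c))).aestronglyMeasurable_map_iff]
  exact hω (cellShift c)

end stationary

lemma ae_norm_le_of_eLpNorm_top_le {α F : Type*} [MeasurableSpace α] {μ : Measure α}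
    [NormedAddCommGroup F] {f : α → F} {B : ℝ≥0} (h : eLpNorm f ∞ μ ≤ B) :
    ∀ᵐ x ∂μ, ‖f x‖ ≤ B := by
  rw [eLpNorm_exponent_top] at h
  filter_upwards [ae_le_eLpNormEssSup (f := f) (μ := μ)] with x hx
  have : ‖f x‖ₑ ≤ (B : ℝ≥0∞) := hx.trans h
  rw [enorm_le_coe] at this
  exact_mod_cast this

lemma ae_norm_le_of_memLp_top {α F : Type*} [MeasurableSpace α] {μ : Measure α}
    [NormedAddCommGroup F] {f : α → F} (h : MemLp f ∞ μ) :
    ∃ B : ℝ≥0, ∀ᵐ x ∂μ, ‖f x‖ ≤ B :=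
  ⟨(eLpNorm f ∞ μ).toNNReal, ae_norm_le_of_eLpNorm_top_le
    (ENNReal.coe_toNNReal h.2.ne).ge⟩

/-- The null set may depend on `ξ`; a countable dense set of `ξ` and continuity in `ξ` make it
uniform. -/
lemma ae_forall_coercive {α : Type*} [MeasurableSpace α] {μ : Measure α} {d : ℕ} {γ : ℝ}
    {a : α → Matrix (Fin d) (Fin d) ℝ}
    (h : ∀ ξ : E d, ∀ᵐ x ∂μ, γ * ‖ξ‖ ^ 2 ≤ inner ℝ ξ (act (a x) ξ)) :
    ∀ᵐ x ∂μ, ∀ ξ : E d, γ * ‖ξ‖ ^ 2 ≤ inner ℝ ξ (act (a x) ξ) := by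
  filter_upwards [ae_all_iff.mpr fun n => h (TopologicalSpace.denseSeq (E d) n)] with x hx ξ
  have hc : Continuous fun ξ : E d => act (a x) ξ :=
    continuous_act.comp (continuous_const.prodMk continuous_id)
  have hcl : IsClosed {ξ : E d | γ * ‖ξ‖ ^ 2 ≤ inner ℝ ξ (act (a x) ξ)} :=
    isClosed_le (by fun_prop) (continuous_id.inner hc)
  exact hcl.closure_subset_iff.mpr (Set.range_subset_iff.mpr hx)
    (TopologicalSpace.denseRange_denseSeq (E d) ξ)

lemma AEPeriodic.stationary {d : ℕ} {Ω β : Type*} [MeasurableSpace Ω] {P : Measure Ω} [SFinite P]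
    [AddAction (Fin d → ℤ) Ω] {f : E d → β} (hf : AEPeriodic 0 f) :
    Stationary P (fun x (_ : Ω) => f x) := fun k =>
  Measure.quasiMeasurePreserving_fst.ae (hf.ae_add_intVec k)

/-! ### The random matrices for almost every realization -/

section random

variable {d : ℕ} {Ω : Type*} [MeasurableSpace Ω] {P : Measure Ω}
  [AddAction (Fin d → ℤ) Ω] {γ : ℝ} {M CR : ℝ≥0} {A : ℝ → E d → Ω → Matrix (Fin d) (Fin d) ℝ}
  {Aper : E d → Matrix (Fin d) (Fin d) ℝ} {A₁ : E d → Ω → Matrix (Fin d) (Fin d) ℝ}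

lemma IsElliptic.mono {N : ℕ} {K K' : ℝ} {a : E d → Matrix (Fin d) (Fin d) ℝ}
    (h : IsElliptic N γ K a) (hK : K ≤ K') : IsElliptic N γ K' a :=
  ⟨h.pos, h.nonneg.trans hK, h.aestronglyMeasurable, h.norm_le.mono fun _ hx => hx.trans hK,
    h.coercive⟩

lemma HasExpansion.ae_norm_remainder_le (hexp : HasExpansion P A Aper A₁ CR) {η : ℝ} (h0 : η ≠ 0)
    (h1 : |η| ≤ 1) : ∀ᵐ z ∂((cubeMeasure d 0).prod P),
      ‖A η z.1 z.2 - Aper z.1 - η • A₁ z.1 z.2‖ ≤ CR * η ^ 2 := by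
  have h := hexp.remainder_le η h0 h1
  have hη : 0 < η ^ 2 := by positivity
  have h2 : normInf P (fun x ω => A η x ω - Aper x - η • A₁ x ω) ≤
      ((CR * (η ^ 2).toNNReal : ℝ≥0) : ℝ≥0∞) := by
    rw [ENNReal.ofReal_inv_of_pos hη, ENNReal.inv_mul_le_iff (by simpa using h0)
      ENNReal.ofReal_ne_top] at h
    rw [mul_comm, ENNReal.coe_mul]
    exact h
  have := ae_norm_le_of_eLpNorm_top_le h2
  simpa [Real.coe_toNNReal _ hη.le] using this

variable [IsProbabilityMeasure P]

lemma IsAdmissible.ae_isElliptic (hγ : 0 < γ) (hA : IsAdmissible P γ M A) {η : ℝ} (h0 : η ≠ 0)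
    (h1 : |η| ≤ 1) : ∀ᵐ ω ∂P, ∀ N, IsElliptic N γ M (fun x => A η x ω) := by
  filter_upwards [ae_aestronglyMeasurable_section (F := A η) (hA.memLp η h0 h1).1,
    ae_ae_of_ae_prod_right (S := fun x ω => ‖A η x ω‖ ≤ M)
      (ae_norm_le_of_eLpNorm_top_le (hA.bounded η h0 h1)),
    ae_ae_of_ae_prod_right
      (S := fun x ω => ∀ ξ : E d, γ * ‖ξ‖ ^ 2 ≤ inner ℝ ξ (act (A η x ω) ξ))
      (ae_forall_coercive (hA.coercive η h0 h1))] with ω e1 e2 e3 N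
  exact ⟨hγ, M.2, e1.restrict, ae_restrict_of_ae e2, ae_restrict_of_ae e3⟩

/-- The remainder is itself stationary, as a combination of stationary fields, so its bound on `Q ×
Ω` propagates. -/
lemma ae_remainder_le [MeasurableConstVAdd (Fin d → ℤ) Ω] [VAddInvariantMeasure (Fin d → ℤ) Ω P]
    (hA : IsAdmissible P γ M A) (hexp : HasExpansion P A Aper A₁ CR) {η : ℝ} (h0 : η ≠ 0)
    (h1 : |η| ≤ 1) : ∀ᵐ ω ∂P, ∀ᵐ x : E d,
      ‖A η x ω - Aper x - η • A₁ x ω‖ ≤ CR * η ^ 2 := by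
  refine Stationary.ae_norm_le (f := fun x ω => A η x ω - Aper x - η • A₁ x ω) (fun k => ?_)
    (hexp.ae_norm_remainder_le h0 h1)
  filter_upwards [hA.stationary η h0 h1 k, hexp.periodic_per.stationary k,
    hexp.stationary_one k] with z e1 e2 e3
  rw [e1, e2, e3]

lemma HasExpansion.ae_bound_one [MeasurableConstVAdd (Fin d → ℤ) Ω]
    [VAddInvariantMeasure (Fin d → ℤ) Ω P] (hexp : HasExpansion P A Aper A₁ CR) :
    ∃ K₁ : ℝ≥0, ∀ᵐ ω ∂P, (∀ N, AEStronglyMeasurable (fun x => A₁ x ω) (cubeMeasure d N)) ∧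
      ∀ᵐ x : E d, ‖A₁ x ω‖ ≤ K₁ := by
  obtain ⟨K₁, hK₁⟩ := ae_norm_le_of_memLp_top hexp.memLp_one
  exact ⟨K₁, (hexp.stationary_one.ae_aestronglyMeasurable hexp.memLp_one.1).and
    (hexp.stationary_one.ae_norm_le hK₁)⟩

/-- The coercivity of `A_η` passes to the limit `A_per`. -/
lemma ae_coercive_per (hA : IsAdmissible P γ M A) (hexp : HasExpansion P A Aper A₁ CR) :
    ∀ᵐ x ∂(cubeMeasure d 0), ∀ ξ : E d, γ * ‖ξ‖ ^ 2 ≤ inner ℝ ξ (act (Aper x) ξ) := by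
  obtain ⟨K₁, hK₁⟩ := ae_norm_le_of_memLp_top hexp.memLp_one
  -- The limit is taken along the sequence `η = 1 / (m + 1)` in `(0, 1]`, so that only countably
  -- many null sets are discarded.
  have hη0 : ∀ m : ℕ, 1 / ((m : ℝ) + 1) ≠ 0 := fun m => by positivity
  have hη1 : ∀ m : ℕ, |1 / ((m : ℝ) + 1)| ≤ 1 := fun m => by
    rw [abs_of_pos (by positivity), div_le_one (by positivity)]
    linarith [(Nat.cast_nonneg m : (0 : ℝ) ≤ m)]
  have h : ∀ᵐ z ∂((cubeMeasure d 0).prod P), ∀ ξ : E d,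
      γ * ‖ξ‖ ^ 2 ≤ inner ℝ ξ (act (Aper z.1) ξ) := by
    filter_upwards [hK₁,
      ae_all_iff.mpr fun m => hexp.ae_norm_remainder_le (hη0 m) (hη1 m),
      ae_all_iff.mpr fun m => ae_cube_prod_of_ae
        (ae_forall_coercive (hA.coercive _ (hη0 m) (hη1 m)))] with z e1 e2 e3 ξ
    have hbound : ∀ m : ℕ, γ * ‖ξ‖ ^ 2 ≤ inner ℝ ξ (act (Aper z.1) ξ) +
        (CR * (1 / ((m : ℝ) + 1)) ^ 2 + 1 / ((m : ℝ) + 1) * K₁) * ‖ξ‖ ^ 2 := by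
      intro m
      set η := 1 / ((m : ℝ) + 1) with hη
      have hpos : 0 < η := by positivity
      have h1 : ‖A η z.1 z.2 - Aper z.1‖ ≤ CR * η ^ 2 + η * K₁ := by
        have e : A η z.1 z.2 - Aper z.1 =
            (A η z.1 z.2 - Aper z.1 - η • A₁ z.1 z.2) + η • A₁ z.1 z.2 := by abel
        rw [e]
        refine (norm_add_le _ _).trans (add_le_add (e2 m) ?_)
        rw [norm_smul, Real.norm_eq_abs, abs_of_pos hpos]
        gcongr
      have h2 : inner ℝ ξ (act (A η z.1 z.2) ξ) = inner ℝ ξ (act (Aper z.1) ξ) +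
          inner ℝ ξ (act (A η z.1 z.2 - Aper z.1) ξ) := by
        rw [← inner_add_right, ← add_act, add_sub_cancel]
      have h3 : inner ℝ ξ (act (A η z.1 z.2 - Aper z.1) ξ) ≤
          (CR * η ^ 2 + η * K₁) * ‖ξ‖ ^ 2 := by
        refine (real_inner_le_norm _ _).trans ?_
        calc ‖ξ‖ * ‖act (A η z.1 z.2 - Aper z.1) ξ‖
            ≤ ‖ξ‖ * ((CR * η ^ 2 + η * K₁) * ‖ξ‖) := by
              gcongr
              exact (norm_act_le _ _).trans (by gcongr)
          _ = _ := by ring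
      linarith [e3 m ξ]
    have ht := tendsto_one_div_add_atTop_nhds_zero_nat (𝕜 := ℝ)
    have hlim : Tendsto (fun m : ℕ => inner ℝ ξ (act (Aper z.1) ξ) +
        (CR * (1 / ((m : ℝ) + 1)) ^ 2 + 1 / ((m : ℝ) + 1) * K₁) * ‖ξ‖ ^ 2) atTop
        (𝓝 (inner ℝ ξ (act (Aper z.1) ξ) + (CR * 0 ^ 2 + 0 * K₁) * ‖ξ‖ ^ 2)) :=
      tendsto_const_nhds.add ((((ht.pow 2).const_mul _).add (ht.mul_const _)).mul_const _)
    have := ge_of_tendsto' hlim hbound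
    simpa using this
  -- The inequality does not involve `ω`, so for almost every `x` a single admissible `ω` suffices;
  -- one exists since `P` is a probability measure.
  filter_upwards [Measure.ae_ae_of_ae_prod h] with x hx
  obtain ⟨ω, hω⟩ := hx.exists
  exact hω

lemma exists_isElliptic_per (hγ : 0 < γ) (hA : IsAdmissible P γ M A)
    (hexp : HasExpansion P A Aper A₁ CR) : ∃ K : ℝ≥0, ∀ N, IsElliptic N γ K Aper := by
  obtain ⟨K, hK⟩ := ae_norm_le_of_memLp_top hexp.memLp_per
  have h : ∀ᵐ x : E d, ‖Aper x‖ ≤ K ∧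
      ∀ ξ : E d, γ * ‖ξ‖ ^ 2 ≤ inner ℝ ξ (act (Aper x) ξ) := by
    refine ae_of_forall_ae_cube_add 0 fun k => ?_
    filter_upwards [hK, ae_coercive_per hA hexp,
      ae_restrict_of_ae (hexp.periodic_per k)] with x e1 e2 e3
    rw [e3]
    exact ⟨e1, e2⟩
  exact ⟨K, fun N => ⟨hγ, K.2,
    hexp.periodic_per.aestronglyMeasurable_cube N hexp.memLp_per.1,
    ae_restrict_of_ae (h.mono fun _ hx => hx.1), ae_restrict_of_ae (h.mono fun _ hx => hx.2)⟩⟩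

/-- One constant `K` dominates the sup norms of `A_η`, `A_per` and `A_1`. It is chosen before `η`,
`ω` and `N`, which is what makes the final constant uniform. -/
lemma exists_ae_isPerturbation [MeasurableConstVAdd (Fin d → ℤ) Ω]
    [VAddInvariantMeasure (Fin d → ℤ) Ω P] (hγ : 0 < γ) (hA : IsAdmissible P γ M A)
    (hexp : HasExpansion P A Aper A₁ CR) : ∃ K : ℝ, 0 ≤ K ∧ ∀ η : ℝ, η ≠ 0 → |η| ≤ 1 →
      ∀ᵐ ω ∂P, ∀ N, IsPerturbation N γ K CR η (fun x => A η x ω) Aper (fun x => A₁ x ω) := by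
  obtain ⟨K₀, hK₀⟩ := exists_isElliptic_per hγ hA hexp
  obtain ⟨K₁, hK₁⟩ := hexp.ae_bound_one
  have p0 : (0 : ℝ) ≤ K₀ := K₀.2
  have p1 : (0 : ℝ) ≤ K₁ := K₁.2
  have p2 : (0 : ℝ) ≤ M := M.2
  refine ⟨M + K₀ + K₁, by positivity, fun η h0 h1 => ?_⟩
  filter_upwards [hA.ae_isElliptic hγ h0 h1, hK₁, ae_remainder_le hA hexp h0 h1] with ω e1 e2 e3 N
  exact ⟨(e1 N).mono (by linarith), hexp.periodic_per, (hK₀ 0).mono (by linarith),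
    (hK₀ N).mono (by linarith), e2.1 N,
    ae_restrict_of_ae (e2.2.mono fun _ hx => hx.trans (by linarith)), CR.2, h1,
    ae_restrict_of_ae e3⟩

end random

end WeakHom

open WeakHom

theorem corollary2p1 {d : ℕ} (hd : 1 ≤ d)
    {Ω : Type*} [MeasurableSpace Ω] (P : Measure Ω) [IsProbabilityMeasure P]
    [AddAction (Fin d → ℤ) Ω] [MeasurableConstVAdd (Fin d → ℤ) Ω]
    [VAddInvariantMeasure (Fin d → ℤ) Ω P]
    (A : ℝ → WeakHom.E d → Ω → Matrix (Fin d) (Fin d) ℝ)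
    (Aper : WeakHom.E d → Matrix (Fin d) (Fin d) ℝ)
    (A₁ : WeakHom.E d → Ω → Matrix (Fin d) (Fin d) ℝ)
    (γ : ℝ) (hγ : 0 < γ) (M CR : ℝ≥0)
    (hA : WeakHom.IsAdmissible P γ M A)
    (hexp : WeakHom.HasExpansion P A Aper A₁ CR) :
    -- the correctors exist, and their gradients are unique
    (∀ p : WeakHom.E d,
      (∃ w₀ g₀, WeakHom.IsCorrector 0 Aper p w₀ g₀ ∧
        ∀ w₀' g₀', WeakHom.IsCorrector 0 Aper p w₀' g₀' → g₀' =ᵐ[volume] g₀) ∧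
      ∀ N : ℕ,
        (∀ η : ℝ, η ≠ 0 → |η| ≤ 1 → ∀ᵐ ω ∂P,
          ∃ w g, WeakHom.IsCorrector N (fun x => A η x ω) p w g ∧
            ∀ w' g', WeakHom.IsCorrector N (fun x => A η x ω) p w' g' → g' =ᵐ[volume] g) ∧
        (∀ᵐ ω ∂P, ∀ w₀ g₀, WeakHom.IsCorrector 0 Aper p w₀ g₀ →
          ∃ w₁ g₁, WeakHom.IsFirstOrderCorrector N Aper (fun x => A₁ x ω) p g₀ w₁ g₁ ∧
            ∀ w₁' g₁', WeakHom.IsFirstOrderCorrector N Aper (fun x => A₁ x ω) p g₀ w₁' g₁' →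
              g₁' =ᵐ[volume] g₁)) ∧
    -- the error bounds, with a constant that is independent of `N`, `η`, `ω`, and of `p`
    ∃ C : ℝ, ∀ (N : ℕ) (η : ℝ), η ≠ 0 → |η| ≤ 1 →
      (∀ p : WeakHom.E d, ‖p‖ = 1 → ∀ᵐ ω ∂P, ∀ w₀ g₀ w g w₁ g₁,
        WeakHom.IsCorrector 0 Aper p w₀ g₀ →
        WeakHom.IsCorrector N (fun x => A η x ω) p w g →
        WeakHom.IsFirstOrderCorrector N Aper (fun x => A₁ x ω) p g₀ w₁ g₁ →
        ENNReal.ofReal ((η ^ 2)⁻¹) *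
            eLpNorm (fun x => g x - g₀ x - η • g₁ x) 2 (WeakHom.cubeMeasure d N) ≤
          ENNReal.ofReal (C * √(volume.real (WeakHom.cube d N)))) ∧
      (∀ᵐ ω ∂P, ∀ (w₀ w w₁ : Fin d → WeakHom.E d → ℝ)
          (g₀ g g₁ : Fin d → WeakHom.E d → WeakHom.E d),
        (∀ j, WeakHom.IsCorrector 0 Aper (EuclideanSpace.single j 1) (w₀ j) (g₀ j)) →
        (∀ j, WeakHom.IsCorrector N (fun x => A η x ω)
          (EuclideanSpace.single j 1) (w j) (g j)) →
        (∀ j, WeakHom.IsFirstOrderCorrector N Aper (fun x => A₁ x ω)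
          (EuclideanSpace.single j 1) (g₀ j) (w₁ j) (g₁ j)) →
        (η ^ 2)⁻¹ * ‖WeakHom.homMatrix N (fun x => A η x ω) g - WeakHom.homMatrix 0 Aper g₀ -
          η • WeakHom.firstOrderMatrix N Aper (fun x => A₁ x ω) g₀ g₁‖ ≤ C) := by
  obtain ⟨K₀, hK₀⟩ := exists_isElliptic_per hγ hA hexp
  obtain ⟨K₁, hK₁⟩ := hexp.ae_bound_one
  refine ⟨fun p => ⟨(hK₀ 0).exists_isCorrector p, fun N => ⟨fun η h0 h1 => ?_, ?_⟩⟩, ?_⟩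
  · filter_upwards [hA.ae_isElliptic hγ h0 h1] with ω hω
    exact (hω N).exists_isCorrector p
  · filter_upwards [hK₁] with ω hω w₀ g₀ h₀
    exact (hK₀ N).exists_isFirstOrderCorrector (hω.1 N) (ae_restrict_of_ae hω.2)
      (h₀.1.of_unit N).memLp_grad p
  obtain ⟨K, hK, hpert⟩ := exists_ae_isPerturbation hγ hA hexp
  set C₁ := γ⁻¹ * sourceConst γ K CR with hC₁
  set C₂ := entryConst γ K CR * ∑ i : Fin d, ∑ j : Fin d, ‖Matrix.single i j (1 : ℝ)‖ with hC₂
  -- `C₁` serves the gradients and `C₂` the matrices; the sum of norms in `C₂` passes from entries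
  -- to the operator norm and depends only on `d`.
  refine ⟨max C₁ C₂, fun N η h0 h1 => ⟨fun p hp => ?_, ?_⟩⟩
  · filter_upwards [hpert η h0 h1] with ω hω w₀ g₀ w g w₁ g₁ h₀ hg h₁
    have hη : 0 < η ^ 2 := by positivity
    have hz := (hω N).isWeakSolution_error h₀ hg h₁
    have h := (hω N).l2norm_error_le h₀ hg h₁
    rw [hp, one_mul] at h
    rw [← ENNReal.ofReal_toReal hz.1.memLp_grad.2.ne, ← ENNReal.ofReal_mul (by positivity)]
    refine ENNReal.ofReal_le_ofReal ?_
    rw [inv_mul_le_iff₀ hη]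
    calc _ ≤ γ⁻¹ * (sourceConst γ K CR * η ^ 2 * √(volume.real (cube d N))) := h
      _ = η ^ 2 * (C₁ * √(volume.real (cube d N))) := by rw [hC₁]; ring
      _ ≤ _ := by gcongr; exact le_max_left _ _
  · filter_upwards [hpert η h0 h1] with ω hω w₀ w w₁ g₀ g g₁ h₀ hg h₁
    have hη : 0 < η ^ 2 := by positivity
    rw [inv_mul_le_iff₀ hη]
    calc _ ≤ entryConst γ K CR * η ^ 2 * ∑ i : Fin d, ∑ j : Fin d, ‖Matrix.single i j (1 : ℝ)‖ :=
          l2_opNorm_le_of_abs_entry_le ((hω N).abs_entry_le h₀ hg h₁)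
      _ = η ^ 2 * C₂ := by rw [hC₂]; ring
      _ ≤ _ := by gcongr; exact le_max_right _ _
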